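/- **Setting.** Fix $\alpha\in[0,1]$. Let $\Delta$ be the set of Borel probability distributions $F$ on $[0,\infty)$, with cdf $F(v)=P[s\le v]$. For a price $p$ let $\mathrm{Rev}(p,F)=p\cdot P_{v\sim F}[v\ge p]$ and $\mathrm{OPT}(F)=\sup_p \mathrm{Rev}(p,F)$. A distribution $F$ is $\alpha$-regular, $F\in\mathcal F_\alpha$, if on $\{v: F(v)<1\}$ it has a density $f$ for which $\varphi(v)=(1-\alpha)v-\frac{1-F(v)}{f(v)}$ (with $\varphi(v)=-\infty$ where $f(v)=0$) is non-decreasing; an atom is allowed at the top of the support. Expectations of payments take values in $[-\infty,\infty]$. A pricing rule $h:\mathbb R\times\Delta\to\mathbb R$ (measurable in the first variable, with all $E_{s\sim F}[h(s,F')]$ well defined in $[-\infty,\infty]$) is *proper* if $E_{s\sim F}[h(s,F)]\le E_{s\sim F}[h(s,F')]$ for all $F,F'\in\Delta$. Write $p_h(F)=E_{s\sim F}[h(s,F)]$. The rule is *monotone* if $p_h(F_1)\ge p_h(F_2)$ whenever $F_1(v)\le F_2(v)$ for all $v$. The hidden pricing mechanism induced by $h$ has allocation $x(s,v,F)=\mathbf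 1[v\ge p_h(F)]$ and payment $t(s,v,F)=x(s,v,F)\,h(s,F)$; it is *monotone* if $h$ is, and *$\Gamma$-approximate* if $E_{s,v\sim F}[t(s,v,F)]\ge\Gamma\cdot\mathrm{OPT}(F)$ for all $F\in\mathcal F_\alpha$, where $s,v$ are independent. Let $\mathcal E(v)=(1+(1-\alpha)v)^{-1/(1-\alpha)}$ if $\alpha<1$ and $\mathcal E(v)=e^{-v}$ if $\alpha=1$. For $\lambda,a\ge 0$ let $\check F_{\lambda,a}$ have cdf $1-\mathcal E(\lambda v)$ on $[0,a)$ and $1$ on $[a,\infty)$. For $\lambda,b\ge0$ with $\lambda b\ge1$ let $\hat F_{\lambda,b}$ have cdf $0$ on $[0,b)$ and $1-\mathcal E(\lambda(v-b))$ on $[b,\infty)$. Let $\mathsf{LB}(F,\Gamma)$ and $\mathsf{UB}(F,\Gamma)\in[-\infty,\infty]$ be the infimum and the supremum of $\{p\in\mathbb R:\mathrm{Rev}(p,F)\ge\Gamma\cdot\mathrm{OPT}(F)\}$. Let $H^\Gamma$ be the set of non-decreasing $g:\mathbb R\to\mathbb R$ with $E_{s\sim\check F_{\lambda,a}}[g(s)]\ge\mathsf{LB}(\check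 F_{\lambda,a},\Gamma)$ for all $\lambda,a\ge0$ with $\alpha\lambda a\le1$. Let $h^\Gamma(\cdot,F)$ be a minimizer of $E_{s\sim F}[g(s)]$ over $g\in H^\Gamma$, and let $\Gamma^*$ be the largest $\Gamma\in[0,1]$ for which, for all $\lambda,b\ge0$ with $\lambda b\ge1$, a minimizer $h^\Gamma(\cdot,\hat F_{\lambda,b})$ exists and satisfies $E_{s\sim\hat F_{\lambda,b}}[h^\Gamma(s,\hat F_{\lambda,b})]\le\mathsf{UB}(\hat F_{\lambda,b},\Gamma)$. **Theorem.** The maximum defining $\Gamma^*$ is attained, and the minimizer $h^{\Gamma^*}(\cdot,F)$ exists for every $F\in\Delta$. For every choice of minimizers, $h^{\Gamma^*}$ is a proper monotone pricing rule, and the hidden pricing mechanism that it induces is $\Gamma^*$-approximate. Moreover, for no $\Gamma>\Gamma^*$ is there a $\Gamma$-approximate monotone hidden pricing mechanism. -/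

import Mathlib

open MeasureTheory Set Filter Topology
open scoped ENNReal NNReal

noncomputable section

namespace HiddenPricing

/-- A valuation distribution: a Borel probability law on the line that charges only `[0, ∞)`. -/
structure ValueDist where
  law : Measure ℝ
  isProb : IsProbabilityMeasure law
  nonneg : law (Iio 0) = 0

instance (F : ValueDist) : IsProbabilityMeasure F.law := F.isProb

/-- The cumulative distribution function `F(v) = P[s ≤ v]`. -/
def ValueDist.cdf (F : ValueDist) (v : ℝ) : ℝ := F.law.real (Iic v)

/-- The extended expectation `E[g⁺] - E[g⁻] ∈ [-∞, ∞]`; it is meaningful when at least one of the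
two terms is finite. -/
def extExp {Ω : Type*} [MeasurableSpace Ω] (μ : Measure Ω) (g : Ω → ℝ) : EReal :=
  ((∫⁻ ω, ENNReal.ofReal (g ω) ∂μ : ℝ≥0∞) : EReal)
    - ((∫⁻ ω, ENNReal.ofReal (-g ω) ∂μ : ℝ≥0∞) : EReal)

/-- First-order stochastic dominance: `F₁` dominates `F₂`. -/
def Dominates (F₁ F₂ : ValueDist) : Prop := ∀ v : ℝ, F₁.cdf v ≤ F₂.cdf v

/-- The revenue `p · P[v ≥ p]` of the posted price `p`. -/
def rev (p : ℝ) (F : ValueDist) : ℝ := p * F.law.real (Ici p)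

/-- The optimal posted-price revenue. -/
def opt (F : ValueDist) : EReal := ⨆ p : ℝ, (rev p F : EReal)

/-! ### Regular distributions -/

/-- The `α`-virtual value `(1-α) v - (1-F(v))/f(v)` for the density `f`; it is `-∞` where
`f(v) = 0`. Only its values at points with `F(v) < 1` are used. -/
def virtualValue (α : ℝ) (F : ValueDist) (f : ℝ → ℝ≥0) (v : ℝ) : EReal :=
  if f v = 0 then ⊥ else (((1 - α) * v - (1 - F.cdf v) / (f v : ℝ) : ℝ) : EReal)

/-- `α`-regularity: below the top of its support the distribution has a density for which the
`α`-virtual value is non-decreasing. An atom is possible only at the top of the support, as for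
truncated distributions and for point masses. -/
def IsRegular (α : ℝ) (F : ValueDist) : Prop :=
  ∃ f : ℝ → ℝ≥0, Measurable f ∧
    (∀ v : ℝ, F.cdf v < 1 → F.law (Iic v) = ∫⁻ x in Iic v, (f x : ℝ≥0∞)) ∧
    MonotoneOn (virtualValue α F f) {v | F.cdf v < 1}

/-- The generalized Pareto survival function. -/
def survE (α v : ℝ) : ℝ :=
  if α = 1 then Real.exp (-v) else (1 + (1 - α) * v) ^ (-1 / (1 - α))

lemma survE_zero (α : ℝ) : survE α 0 = 1 := by
  unfold survE; split_ifs <;> simp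

lemma survE_nonneg {α v : ℝ} (hα : α ≤ 1) (hv : 0 ≤ v) : 0 ≤ survE α v := by
  unfold survE
  split_ifs
  · positivity
  · have : 0 ≤ (1 - α) * v := mul_nonneg (by linarith) hv
    exact Real.rpow_nonneg (by linarith) _

lemma survE_antitone {α x y : ℝ} (hα : α ≤ 1) (hx : 0 ≤ x) (hxy : x ≤ y) :
    survE α y ≤ survE α x := by
  unfold survE
  split_ifs with h
  · exact Real.exp_le_exp.2 (by linarith)
  · have h1 : 0 < 1 - α := by
      rcases lt_or_eq_of_le hα with h2 | h2
      · linarith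
      · exact absurd h2 h
    have h3 : 0 ≤ (1 - α) * x := mul_nonneg h1.le hx
    have h4 : (1 - α) * x ≤ (1 - α) * y := mul_le_mul_of_nonneg_left hxy h1.le
    apply Real.rpow_le_rpow_of_nonpos (by linarith) (by linarith)
    rw [neg_div]
    have : 0 < 1 / (1 - α) := by positivity
    linarith

lemma survE_continuous {α : ℝ} (hα : α ≤ 1) {g : ℝ → ℝ} (hg : Continuous g)
    (hg0 : ∀ v, 0 ≤ g v) : Continuous fun v => survE α (g v) := by
  unfold survE
  split_ifs
  · fun_prop
  · apply Continuous.rpow_const (by fun_prop)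
    intro v
    left
    have : 0 ≤ (1 - α) * g v := mul_nonneg (by linarith) (hg0 v)
    linarith

lemma survE_tendsto {α : ℝ} (hα : α ≤ 1) : Tendsto (survE α) atTop (𝓝 0) := by
  by_cases h : α = 1
  · have : survE α = fun v => Real.exp (-v) := by
      funext v; simp [survE, h]
    rw [this]
    exact Real.tendsto_exp_neg_atTop_nhds_zero
  · have h1 : 0 < 1 - α := by
      rcases lt_or_eq_of_le hα with h2 | h2
      · linarith
      · exact absurd h2 h
    have h2 : survE α = fun v => (1 + (1 - α) * v) ^ (-(1 / (1 - α))) := by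
      funext v; simp only [survE, if_neg h, neg_div]
    rw [h2]
    exact (tendsto_rpow_neg_atTop (by positivity : 0 < 1 / (1 - α))).comp
      (tendsto_atTop_add_const_left _ _ (tendsto_id.const_mul_atTop h1))

/-- The distribution whose cumulative distribution function is a given Stieltjes function. -/
def ofCdf (f : StieltjesFunction ℝ) (h0 : ∀ v < 0, f v = 0) (h1 : Tendsto f atTop (𝓝 1)) :
    ValueDist where
  law := f.measure
  isProb := by
    refine f.isProbabilityMeasure (Tendsto.congr' ?_ tendsto_const_nhds) h1
    filter_upwards [eventually_lt_atBot (0 : ℝ)] with v hv using (h0 v hv).symm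
  nonneg := by
    have hb : Tendsto f atBot (𝓝 0) := by
      refine Tendsto.congr' ?_ tendsto_const_nhds
      filter_upwards [eventually_lt_atBot (0 : ℝ)] with v hv using (h0 v hv).symm
    rw [f.measure_Iio hb]
    have hl : Function.leftLim f 0 = 0 := by
      apply leftLim_eq_of_tendsto
      refine Tendsto.congr' ?_ tendsto_const_nhds
      filter_upwards [self_mem_nhdsWithin] with v hv using (h0 v hv).symm
    simp [hl]

lemma ofCdf_cdf (f : StieltjesFunction ℝ) (h0 : ∀ v < 0, f v = 0)
    (h1 : Tendsto f atTop (𝓝 1)) (v : ℝ) : (ofCdf f h0 h1).cdf v = f v := by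
  have hb : Tendsto f atBot (𝓝 0) := by
    refine Tendsto.congr' ?_ tendsto_const_nhds
    filter_upwards [eventually_lt_atBot (0 : ℝ)] with v hv using (h0 v hv).symm
  have hv : 0 ≤ f v := by
    have := f.mono (min_le_left v (-1))
    rwa [h0 _ (lt_of_le_of_lt (min_le_right v (-1)) (by norm_num))] at this
  simp [ValueDist.cdf, ofCdf, Measure.real, f.measure_Iic hb, hv]

/-- The cumulative distribution function `1 - E(l v)` on `[0, a)`, and `1` on `[a, ∞)`. -/
def minimalCdf (α : Icc (0 : ℝ) 1) (l a : ℝ≥0) : StieltjesFunction ℝ where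
  toFun v := if v < 0 then 0 else if v < a then 1 - survE α (l * v) else 1
  mono' := by
    intro x y hxy
    have hα : (α : ℝ) ≤ 1 := α.2.2
    have hl : (0 : ℝ) ≤ l := l.2
    have hE : ∀ v : ℝ, 0 ≤ v → survE α (l * v) ≤ 1 := fun v hv => by
      have := survE_antitone hα le_rfl (mul_nonneg hl hv)
      rwa [survE_zero] at this
    simp only
    split_ifs with h1 h2 h3 h4 h5 h6 h7 h8
    any_goals linarith
    · have := hE y (not_lt.1 h2); linarith
    · have := survE_antitone hα (mul_nonneg hl (not_lt.1 h1))
        (mul_le_mul_of_nonneg_left hxy hl)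
      linarith
    · have := survE_nonneg hα (mul_nonneg hl (not_lt.1 h1)); linarith
  right_continuous' := by
    intro x
    have hα : (α : ℝ) ≤ 1 := α.2.2
    have hl : (0 : ℝ) ≤ l := l.2
    have ha : (0 : ℝ) ≤ a := a.2
    rcases lt_or_ge x a with hx | hx
    · have hc : Continuous fun v : ℝ => 1 - survE α (l * max v 0) :=
        continuous_const.sub (survE_continuous hα (by fun_prop)
          fun v => mul_nonneg hl (le_max_right _ _))
      refine (hc.continuousAt.congr ?_).continuousWithinAt
      filter_upwards [Iio_mem_nhds hx] with v hv
      have hv' : v < a := hv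
      rcases lt_or_ge v 0 with h | h
      · simp [h, max_eq_right h.le, survE_zero]
      · simp [not_lt.2 h, max_eq_left h, hv']
    · have hc : ∀ v ∈ Ici x,
          (if v < 0 then (0 : ℝ) else if v < a then 1 - survE α (l * v) else 1) = 1 := by
        intro v hv
        have hv' : x ≤ v := hv
        rw [if_neg (by linarith), if_neg (by linarith)]
      exact continuousWithinAt_const.congr hc (hc x self_mem_Ici)

/-- The minimal `α`-regular distribution with parameters `(l, a)`. -/
def minimalDist (α : Icc (0 : ℝ) 1) (l a : ℝ≥0) : ValueDist :=
  ofCdf (minimalCdf α l a) (fun v hv => if_pos hv) (by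
    refine Tendsto.congr' ?_ tendsto_const_nhds
    filter_upwards [eventually_ge_atTop (a : ℝ)] with v hv
    have ha : (0 : ℝ) ≤ a := a.2
    change 1 = if v < 0 then (0 : ℝ) else if v < a then 1 - survE α (l * v) else 1
    rw [if_neg (by linarith), if_neg (by linarith)])

/-- The cumulative distribution function `0` on `[0, b)`, and `1 - E(l (v - b))` on `[b, ∞)`. -/
def maximalCdf (α : Icc (0 : ℝ) 1) (l b : ℝ≥0) : StieltjesFunction ℝ where
  toFun v := if v < b then 0 else 1 - survE α (l * (v - b))
  mono' := by
    intro x y hxy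
    have hα : (α : ℝ) ≤ 1 := α.2.2
    have hl : (0 : ℝ) ≤ l := l.2
    simp only
    split_ifs with h1 h2 h3
    any_goals linarith
    · have := survE_antitone hα le_rfl (mul_nonneg hl (sub_nonneg.2 (not_lt.1 h2)))
      rw [survE_zero] at this
      linarith
    · have := survE_antitone hα (mul_nonneg hl (sub_nonneg.2 (not_lt.1 h1)))
        (mul_le_mul_of_nonneg_left (sub_le_sub_right hxy (b : ℝ)) hl)
      linarith
  right_continuous' := by
    intro x
    have hα : (α : ℝ) ≤ 1 := α.2.2
    have hl : (0 : ℝ) ≤ l := l.2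
    have hc : Continuous fun v : ℝ => 1 - survE α (l * max (v - b) 0) :=
      continuous_const.sub (survE_continuous hα (by fun_prop)
        fun v => mul_nonneg hl (le_max_right _ _))
    refine (hc.continuousAt.congr (Eventually.of_forall fun v => ?_)).continuousWithinAt
    rcases lt_or_ge v b with h | h
    · simp [h, max_eq_right (sub_nonpos.2 h.le), survE_zero]
    · simp [not_lt.2 h, max_eq_left (sub_nonneg.2 h)]

/-- The maximal `α`-regular distribution with parameters `(l, b)`, where `l b ≥ 1`. -/
def maximalDist (α : Icc (0 : ℝ) 1) (l b : ℝ≥0) (h : 1 ≤ l * b) : ValueDist :=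
  ofCdf (maximalCdf α l b) (fun v hv => if_pos (hv.trans_le b.2)) (by
    have hl : (0 : ℝ) < l := by
      rcases eq_or_lt_of_le l.2 with h0 | h0
      · have : l = 0 := NNReal.eq h0.symm
        simp [this] at h
      · exact h0
    have ht : Tendsto (fun v : ℝ => 1 - survE α (l * (v - b))) atTop (𝓝 (1 - 0)) :=
      tendsto_const_nhds.sub ((survE_tendsto α.2.2).comp
        ((tendsto_atTop_add_const_right _ (-(b : ℝ)) tendsto_id).const_mul_atTop hl))
    rw [sub_zero] at ht
    refine ht.congr' ?_
    filter_upwards [eventually_ge_atTop (b : ℝ)] with v hv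
    exact (if_neg (not_lt.2 hv)).symm)

lemma minimalDist_cdf (α : Icc (0 : ℝ) 1) (l a : ℝ≥0) (v : ℝ) :
    (minimalDist α l a).cdf v
      = if v < 0 then 0 else if v < a then 1 - survE α (l * v) else 1 :=
  ofCdf_cdf _ _ _ v

lemma maximalDist_cdf (α : Icc (0 : ℝ) 1) (l b : ℝ≥0) (h : 1 ≤ l * b) (v : ℝ) :
    (maximalDist α l b h).cdf v = if v < b then 0 else 1 - survE α (l * (v - b)) :=
  ofCdf_cdf _ _ _ v

/-! ### Hidden pricing mechanisms -/

/-- A direct mechanism: an allocation and a payment as functions of the hidden sample, the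
reported value and the reported distribution. -/
structure Mechanism where
  alloc : ℝ → ℝ → ValueDist → ℝ
  pay : ℝ → ℝ → ValueDist → ℝ

/-- The expected payment when the sample and the value are drawn independently from `F` and the
buyer reports truthfully. -/
def Mechanism.revenue (M : Mechanism) (F : ValueDist) : EReal :=
  extExp (F.law.prod F.law) fun z => M.pay z.1 z.2 F

/-- `Γ`-approximation of the optimal revenue on all `α`-regular distributions. -/
def Mechanism.IsApprox (α Γ : ℝ) (M : Mechanism) : Prop :=
  ∀ F : ValueDist, IsRegular α F → (Γ : EReal) * opt F ≤ M.revenue F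

/-- A proper pricing rule: all expected payments are well defined (possibly infinite), and
reporting the true distribution minimizes the expected payment. -/
structure IsProperRule (h : ℝ → ValueDist → ℝ) : Prop where
  measurable : ∀ F', Measurable fun s => h s F'
  quasiIntegrable : ∀ F F' : ValueDist,
    ∫⁻ s, ENNReal.ofReal (h s F') ∂F.law ≠ ⊤ ∨ ∫⁻ s, ENNReal.ofReal (-h s F') ∂F.law ≠ ⊤
  proper : ∀ F F' : ValueDist,
    extExp F.law (fun s => h s F) ≤ extExp F.law (fun s => h s F')

/-- The pricing policy `p(F) = E_{s ∼ F}[h(s, F)]` implemented by a pricing rule. -/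
def policy (h : ℝ → ValueDist → ℝ) (F : ValueDist) : EReal := extExp F.law fun s => h s F

/-- Monotonicity of a pricing rule: its pricing policy is monotone for stochastic dominance. -/
def IsMonotoneRule (h : ℝ → ValueDist → ℝ) : Prop :=
  ∀ F₁ F₂ : ValueDist, Dominates F₁ F₂ → policy h F₂ ≤ policy h F₁

open Classical in
/-- The hidden pricing mechanism of a pricing rule. -/
def hiddenMechanism (h : ℝ → ValueDist → ℝ) : Mechanism where
  alloc _ v F := if policy h F ≤ (v : EReal) then 1 else 0
  pay s v F := (if policy h F ≤ (v : EReal) then 1 else 0) * h s F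

/-! ### The optimal monotone pricing rule -/

/-- The lowest `Γ`-approximate price. -/
def lowerPrice (F : ValueDist) (Γ : ℝ) : EReal :=
  sInf ((fun p : ℝ => (p : EReal)) '' {p : ℝ | (Γ : EReal) * opt F ≤ (rev p F : EReal)})

/-- The highest `Γ`-approximate price (it may be `∞`). -/
def upperPrice (F : ValueDist) (Γ : ℝ) : EReal :=
  sSup ((fun p : ℝ => (p : EReal)) '' {p : ℝ | (Γ : EReal) * opt F ≤ (rev p F : EReal)})

/-- The feasible pricing functions `H^Γ`. -/
def feasible (α : Icc (0 : ℝ) 1) (Γ : ℝ) : Set (ℝ → ℝ) :=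
  {g | Monotone g ∧ ∀ l a : ℝ≥0, (α : ℝ) * l * a ≤ 1 →
    lowerPrice (minimalDist α l a) Γ ≤ extExp (minimalDist α l a).law g}

/-- `g` minimizes the expected payment under `F` among all feasible pricing functions, that is,
`g ∈ argmin_{h ∈ H^Γ} E_{s ∼ F}[h(s)]`. -/
def IsBuyerOptimal (α : Icc (0 : ℝ) 1) (Γ : ℝ) (F : ValueDist) (g : ℝ → ℝ) : Prop :=
  g ∈ feasible α Γ ∧ ∀ g' ∈ feasible α Γ, extExp F.law g ≤ extExp F.law g'

/-- `h` is a version of the rule `h^Γ`: for each `F` it selects a minimizer. -/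
def IsOptimalRule (α : Icc (0 : ℝ) 1) (Γ : ℝ) (h : ℝ → ValueDist → ℝ) : Prop :=
  ∀ F : ValueDist, IsBuyerOptimal α Γ F fun s => h s F

/-- The `Γ ∈ [0,1]` for which the minimal expected payment is at most the highest
`Γ`-approximate price, on every maximal distribution. -/
def admissibleRatios (α : Icc (0 : ℝ) 1) : Set ℝ :=
  {Γ | Γ ∈ Icc (0 : ℝ) 1 ∧ ∀ (l b : ℝ≥0) (hlb : 1 ≤ l * b),
    ∃ g, IsBuyerOptimal α Γ (maximalDist α l b hlb) g ∧
      extExp (maximalDist α l b hlb).law g ≤ upperPrice (maximalDist α l b hlb) Γ}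

/-- The tight approximation ratio `Γ*`. -/
def tightRatio (α : Icc (0 : ℝ) 1) : ℝ := sSup (admissibleRatios α)

end HiddenPricing

end

/-!
The argument rests on a description of regular distributions by supporting lines. Write a survival
function as `E ∘ W`, where `E` is the generalized Pareto survival function. `α`-regularity means
that `W` is convex; the form in which this is used is `IsRegular.exists_supporting_line`, which
compares the survival function with `E` of a line by means of the fundamental theorem of calculus
for absolutely continuous functions. Minimal distributions correspond to lines through the origin,
cut off at `a`, and maximal ones to the positive part of a line vanishing at `b`.

*Approximation.* Let `a` be an optimal price of a regular `F`. The chord of `W` from the origin to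
`a` gives a minimal distribution dominated by `F`, with the same optimal revenue and a lower
revenue curve below `a` (`IsRegular.exists_minimalDist`). A supporting line of `W` to the right of
`a`, shifted to the right where it is too flat, gives a maximal distribution dominating `F` whose
largest `Γ`-approximate price exceeds that of `F` by at most an arbitrarily small amount
(`IsRegular.exists_maximalDist`). Hence the constraints on the expected payment under minimal and
maximal distributions carry over to `F` by stochastic dominance: the price implemented at the ratio
`Γ*` is `Γ*`-approximate for every regular `F` (`IsOptimalRule.isApprox`). Properness and
monotonicity follow from the definition of the rule as a minimizer among non-decreasing functions.

*Attainment.* Feasible pricing functions are non-negative on the half-line, and bounds on their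
expectations bound them pointwise, so Helly's selection theorem applies. Constraints are preserved
because minimal distributions have compact support, and the objective is lower semicontinuous by
Fatou's lemma (`exists_feasible_limit`). Where the expectation under `F` gives no bound, a feasible
function can be truncated (`truncate_mem_feasible`), since for `α > 0` the atoms of the minimal
distributions are bounded below. For `α = 0` the maximal distributions have infinite mean, and no
positive ratio is admissible (`not_exists_feasible_of_eq_zero`).

*Optimality.* For a proper monotone rule `h` that is `Γ`-approximate and a maximal distribution `F`,
the largest non-decreasing function below `h(·, F)` belongs to `H^Γ`: moving every sample to the
right, to a point where `h(·, F)` nearly attains its infimum, replaces a minimal distribution by a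
dominating one (`exists_feasible_of_isApprox`). So `Γ` is admissible.
-/

namespace HiddenPricing

/-! ### The generalized Pareto survival function -/

section survE

variable {α : ℝ}

lemma survE_of_ne (h : α ≠ 1) (v : ℝ) : survE α v = (1 + (1 - α) * v) ^ (-1 / (1 - α)) := if_neg h

lemma survE_one (v : ℝ) : survE 1 v = Real.exp (-v) := if_pos rfl

lemma survE_pos {v : ℝ} (h : 0 < 1 + (1 - α) * v) : 0 < survE α v := by
  unfold survE
  split_ifs
  · positivity
  · exact Real.rpow_pos_of_pos h _

lemma one_add_mul_pos {v : ℝ} (hα : α ≤ 1) (hv : 0 ≤ v) : 0 < 1 + (1 - α) * v := by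
  have := mul_nonneg (sub_nonneg.2 hα) hv
  linarith

/-- `E` solves `E' = -E / (1 + (1 - α) v)`: its hazard rate is `1 / (1 + (1 - α) v)`. -/
lemma hasDerivAt_survE {v : ℝ} (h : 0 < 1 + (1 - α) * v) :
    HasDerivAt (survE α) (-survE α v / (1 + (1 - α) * v)) v := by
  by_cases h1 : α = 1
  · subst h1
    have : survE 1 = fun v => Real.exp (-v) := funext survE_one
    rw [this]
    convert (hasDerivAt_neg v).exp using 1
    simp
  · have h2 : 1 - α ≠ 0 := sub_ne_zero.2 (Ne.symm h1)
    have : survE α = fun v => (1 + (1 - α) * v) ^ (-1 / (1 - α)) := funext (survE_of_ne h1)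
    rw [this]
    have h3 : HasDerivAt (fun v : ℝ => 1 + (1 - α) * v) (1 - α) v := by
      simpa using ((hasDerivAt_id v).const_mul (1 - α)).const_add 1
    convert h3.rpow_const (p := -1 / (1 - α)) (Or.inl h.ne') using 1
    rw [Real.rpow_sub_one h.ne']
    field_simp

lemma contDiffAt_survE {v : ℝ} (h : 0 < 1 + (1 - α) * v) : ContDiffAt ℝ 1 (survE α) v := by
  unfold survE
  split_ifs
  · fun_prop
  · exact ContDiffAt.rpow_const_of_ne (by fun_prop) h.ne'

lemma survE_lt {v w : ℝ} (hα : α ≤ 1) (h : 0 < 1 + (1 - α) * v) (hvw : v < w) :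
    survE α w < survE α v := by
  by_cases h1 : α = 1
  · subst h1; rw [survE_one, survE_one]; exact Real.exp_lt_exp.2 (by linarith)
  · have h2 : 0 < 1 - α := sub_pos.2 (lt_of_le_of_ne hα h1)
    rw [survE_of_ne h1, survE_of_ne h1]
    have h3 : (1 - α) * v < (1 - α) * w := mul_lt_mul_of_pos_left hvw h2
    apply Real.rpow_lt_rpow_of_neg h (by linarith)
    rw [neg_div]
    have : 0 < 1 / (1 - α) := by positivity
    linarith

lemma survE_le {v w : ℝ} (hα : α ≤ 1) (h : 0 < 1 + (1 - α) * v) (hvw : v ≤ w) :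
    survE α w ≤ survE α v := by
  rcases hvw.eq_or_lt with rfl | h1
  · exact le_rfl
  · exact (survE_lt hα h h1).le

lemma survE_le_iff {v w : ℝ} (hα : α ≤ 1) (hv : 0 ≤ v) (hw : 0 ≤ w) :
    survE α v ≤ survE α w ↔ w ≤ v := by
  refine ⟨fun h => ?_, fun h => survE_antitone hα hw h⟩
  by_contra h1
  exact absurd h (not_le.2 (survE_lt hα (one_add_mul_pos hα hv) (not_le.1 h1)))

lemma exists_survE_eq {t : ℝ} (hα : α ≤ 1) (h0 : 0 < t) (h1 : t ≤ 1) :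
    ∃ w, 0 ≤ w ∧ survE α w = t := by
  obtain ⟨M, hM0, hM⟩ := ((eventually_ge_atTop (0 : ℝ)).and
    ((survE_tendsto hα).eventually (gt_mem_nhds h0))).exists
  have hc : ContinuousOn (survE α) (Icc 0 M) := fun x hx =>
    (hasDerivAt_survE (one_add_mul_pos hα hx.1)).continuousAt.continuousWithinAt
  obtain ⟨w, hw, hwt⟩ := intermediate_value_Icc' hM0 hc ⟨hM.le, by rwa [survE_zero]⟩
  exact ⟨w, hw.1, hwt⟩

/-- Log-convexity of `E`, as a statement about the ratios `E(w) / E(w - d)`. -/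
lemma survE_mul_le {w w' d : ℝ} (hα : α ≤ 1) (hd : 0 ≤ d) (hw : w' ≤ w)
    (h : 0 < 1 + (1 - α) * (w' - d)) :
    survE α w' * survE α (w - d) ≤ survE α w * survE α (w' - d) := by
  by_cases h1 : α = 1
  · subst h1
    simp only [survE_one, ← Real.exp_add]
    exact Real.exp_le_exp.2 (by linarith)
  · have h2 : 0 < 1 - α := sub_pos.2 (lt_of_le_of_ne hα h1)
    simp only [survE_of_ne h1]
    have a1 : (1 - α) * (w' - d) ≤ (1 - α) * w' := by gcongr; linarith
    have a2 : (1 - α) * (w' - d) ≤ (1 - α) * (w - d) := by gcongr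
    have a3 : (1 - α) * (w' - d) ≤ (1 - α) * w := by gcongr; linarith
    rw [← Real.mul_rpow (by linarith) (by linarith), ← Real.mul_rpow (by linarith) (by linarith)]
    apply Real.rpow_le_rpow_of_nonpos
    · exact mul_pos (by linarith) (by linarith)
    · have : 0 ≤ (1 - α) ^ 2 * (d * (w - w')) :=
        mul_nonneg (sq_nonneg _) (mul_nonneg hd (by linarith))
      nlinarith
    · rw [neg_div]
      have : 0 < 1 / (1 - α) := by positivity
      linarith

lemma hasDerivAt_mul_survE {β y : ℝ} (h : 0 < 1 + (1 - α) * (y - β)) :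
    HasDerivAt (fun y => y * survE α (y - β))
      (survE α (y - β) / (1 + (1 - α) * (y - β)) * (1 - (1 - α) * β - α * y)) y := by
  have h1 : HasDerivAt (fun y => survE α (y - β))
      (-survE α (y - β) / (1 + (1 - α) * (y - β))) y := by
    simpa using (hasDerivAt_survE h).comp_sub_const y β
  refine ((hasDerivAt_id' y).mul h1).congr_deriv ?_
  rw [div_mul_eq_mul_div, mul_div_assoc', one_mul, eq_div_iff h.ne', add_mul,
    div_mul_cancel₀ _ h.ne']
  ring

/-- The revenue curve `y E(y - β)` increases up to its stationary point. -/
lemma mul_survE_mono {β y z : ℝ} (hα0 : 0 ≤ α) (hα : α ≤ 1) (hy : 0 < 1 + (1 - α) * (y - β))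
    (hyz : y ≤ z) (hz : α * z ≤ 1 - (1 - α) * β) :
    y * survE α (y - β) ≤ z * survE α (z - β) := by
  have hD : ∀ x ∈ Icc y z, 0 < 1 + (1 - α) * (x - β) := fun x hx => by
    have : (1 - α) * (y - β) ≤ (1 - α) * (x - β) := by
      gcongr
      exact hx.1
    linarith
  refine monotoneOn_of_deriv_nonneg (convex_Icc y z)
    (fun x hx => (hasDerivAt_mul_survE (hD x hx)).continuousAt.continuousWithinAt)
    (fun x hx =>
      (hasDerivAt_mul_survE (hD x (interior_subset hx))).differentiableAt.differentiableWithinAt)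
    (fun x hx => ?_) (left_mem_Icc.2 hyz) (right_mem_Icc.2 hyz) hyz
  have hx' := interior_subset hx
  rw [(hasDerivAt_mul_survE (hD x hx')).deriv]
  have : α * x ≤ α * z := by gcongr; exact hx'.2
  exact mul_nonneg (div_nonneg (survE_pos (hD x hx')).le (hD x hx').le) (by linarith)

/-- The revenue curve `y E(y - β)` decreases from its stationary point on. -/
lemma mul_survE_anti {β y z : ℝ} (hα0 : 0 ≤ α) (hα : α ≤ 1) (hy : 0 < 1 + (1 - α) * (y - β))
    (hyz : y ≤ z) (hz : 1 - (1 - α) * β ≤ α * y) :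
    z * survE α (z - β) ≤ y * survE α (y - β) := by
  have hD : ∀ x ∈ Icc y z, 0 < 1 + (1 - α) * (x - β) := fun x hx => by
    have : (1 - α) * (y - β) ≤ (1 - α) * (x - β) := by
      gcongr
      exact hx.1
    linarith
  refine antitoneOn_of_deriv_nonpos (convex_Icc y z)
    (fun x hx => (hasDerivAt_mul_survE (hD x hx)).continuousAt.continuousWithinAt)
    (fun x hx =>
      (hasDerivAt_mul_survE (hD x (interior_subset hx))).differentiableAt.differentiableWithinAt)
    (fun x hx => ?_) (left_mem_Icc.2 hyz) (right_mem_Icc.2 hyz) hyz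
  have hx' := interior_subset hx
  rw [(hasDerivAt_mul_survE (hD x hx')).deriv]
  have : α * y ≤ α * x := by gcongr; exact hx'.1
  exact mul_nonpos_of_nonneg_of_nonpos
    (div_nonneg (survE_pos (hD x hx')).le (hD x hx').le) (by linarith)

lemma mul_survE_strictAnti {β y z : ℝ} (hα0 : 0 < α) (hα : α ≤ 1)
    (hy : 0 < 1 + (1 - α) * (y - β)) (hyz : y < z) (hz : 1 - (1 - α) * β ≤ α * y) :
    z * survE α (z - β) < y * survE α (y - β) := by
  have hD : ∀ x ∈ Icc y z, 0 < 1 + (1 - α) * (x - β) := fun x hx => by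
    have : (1 - α) * (y - β) ≤ (1 - α) * (x - β) := by
      gcongr
      exact hx.1
    linarith
  refine strictAntiOn_of_deriv_neg (convex_Icc y z)
    (fun x hx => (hasDerivAt_mul_survE (hD x hx)).continuousAt.continuousWithinAt)
    (fun x hx => ?_) (left_mem_Icc.2 hyz.le) (right_mem_Icc.2 hyz.le) hyz
  have hx' := interior_subset hx
  rw [interior_Icc] at hx
  rw [(hasDerivAt_mul_survE (hD x hx')).deriv]
  have : α * y < α * x := by gcongr; exact hx.1
  exact mul_neg_of_pos_of_neg (div_pos (survE_pos (hD x hx')) (hD x hx')) (by linarith)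

/-- For `α > 0` the tail of `E` is lighter than `1 / v`, so revenues vanish at high prices. -/
lemma tendsto_mul_survE {l : ℝ} (hα0 : 0 < α) (hα : α ≤ 1) (hl : 0 < l) :
    Tendsto (fun y => y * survE α (l * y)) atTop (𝓝 0) := by
  by_cases h1 : α = 1
  · subst h1
    simp only [survE_one]
    have := Real.tendsto_pow_mul_exp_neg_atTop_nhds_zero 1
    have h2 := (this.comp (tendsto_id.const_mul_atTop hl)).const_mul (1 / l)
    rw [mul_zero] at h2
    refine h2.congr fun y => ?_
    simp only [Function.comp, id, pow_one]
    field_simp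
  · have h2 : 0 < 1 - α := sub_pos.2 (lt_of_le_of_ne hα h1)
    simp only [survE_of_ne h1]
    have h3 : Tendsto (fun y : ℝ => ((1 - α) * l) ^ (-1 / (1 - α)) * y ^ (-(α / (1 - α)))) atTop
        (𝓝 (((1 - α) * l) ^ (-1 / (1 - α)) * 0)) :=
      (tendsto_rpow_neg_atTop (by positivity)).const_mul _
    rw [mul_zero] at h3
    refine squeeze_zero' ?_ ?_ h3
    · filter_upwards [eventually_ge_atTop 0] with y hy
      positivity
    · filter_upwards [eventually_gt_atTop 0] with y hy
      have h4 : y ^ (-(α / (1 - α))) = y * y ^ (-1 / (1 - α)) := by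
        nth_rewrite 2 [← Real.rpow_one y]
        rw [← Real.rpow_add hy]
        congr 1
        field_simp
        ring
      rw [h4, mul_left_comm (((1 - α) * l) ^ (-1 / (1 - α))), ← Real.mul_rpow (by positivity) hy.le]
      refine mul_le_mul_of_nonneg_left ?_ hy.le
      apply Real.rpow_le_rpow_of_nonpos (by positivity)
      · linarith
      · rw [neg_div]
        have : 0 < 1 / (1 - α) := by positivity
        linarith

lemma tendsto_mul_survE_sub {l : ℝ} (b : ℝ) (hα0 : 0 < α) (hα : α ≤ 1) (hl : 0 < l) :
    Tendsto (fun y => y * survE α (l * (y - b))) atTop (𝓝 0) := by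
  have h1 : Tendsto (fun y : ℝ => y - b) atTop atTop :=
    tendsto_atTop_add_const_right _ (-b) tendsto_id
  have h2 := ((tendsto_mul_survE hα0 hα hl).comp h1).add
    (((survE_tendsto hα).comp (h1.const_mul_atTop hl)).const_mul b)
  rw [mul_zero, add_zero] at h2
  refine h2.congr fun y => ?_
  simp only [Function.comp]
  ring

end survE

/-! ### Survival functions and extended expectations -/

section basics

variable {F F₁ F₂ : ValueDist} {g : ℝ → ℝ}

lemma ae_nonneg (F : ValueDist) : ∀ᵐ s ∂F.law, 0 ≤ s := by
  rw [ae_iff]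
  convert F.nonneg using 2
  ext s
  simp

lemma real_Ioi (F : ValueDist) (v : ℝ) : F.law.real (Ioi v) = 1 - F.cdf v := by
  rw [← compl_Iic, probReal_compl_eq_one_sub measurableSet_Iic]
  rfl

lemma real_Ici_of_nonpos (F : ValueDist) {v : ℝ} (hv : v ≤ 0) : F.law.real (Ici v) = 1 := by
  rw [measureReal_def, (mem_ae_iff_prob_eq_one measurableSet_Ici).1]
  · rfl
  · filter_upwards [ae_nonneg F] with s hs using hv.trans hs

lemma real_Ioi_of_neg (F : ValueDist) {v : ℝ} (hv : v < 0) : F.law.real (Ioi v) = 1 := by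
  rw [measureReal_def, (mem_ae_iff_prob_eq_one measurableSet_Ioi).1]
  · rfl
  · filter_upwards [ae_nonneg F] with s hs using hv.trans_le hs

lemma real_Ici_anti (F : ValueDist) {v w : ℝ} (h : v ≤ w) :
    F.law.real (Ici w) ≤ F.law.real (Ici v) := measureReal_mono (Ici_subset_Ici.2 h)

lemma tendsto_real_Ioi (F : ValueDist) (x : ℝ) :
    Tendsto (fun v => F.law.real (Ioi v)) (𝓝[<] x) (𝓝 (F.law.real (Ici x))) := by
  have h1 : F.law.real (Ici x) = 1 - Function.leftLim (ProbabilityTheory.cdf F.law) x := by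
    have := (ProbabilityTheory.cdf F.law).measure_Ici (ProbabilityTheory.tendsto_cdf_atTop F.law) x
    rw [ProbabilityTheory.measure_cdf] at this
    rw [measureReal_def, this, ENNReal.toReal_ofReal]
    rw [sub_nonneg]
    exact ((ProbabilityTheory.monotone_cdf F.law).leftLim_le le_rfl).trans
      (ProbabilityTheory.cdf_le_one F.law x)
  rw [h1]
  refine (((ProbabilityTheory.monotone_cdf F.law).tendsto_leftLim x).const_sub 1).congr fun v => ?_
  rw [real_Ioi, ProbabilityTheory.cdf_eq_real]
  rfl

lemma real_Ici_eq_of_tendsto {x c : ℝ} {S : ℝ → ℝ} (h : ∀ᶠ v in 𝓝[<] x, F.law.real (Ioi v) = S v)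
    (hS : Tendsto S (𝓝[<] x) (𝓝 c)) : F.law.real (Ici x) = c :=
  tendsto_nhds_unique ((tendsto_real_Ioi F x).congr' h) hS

lemma exists_real_Ici_lt (F : ValueDist) {x c : ℝ} (h : F.law.real (Ici x) < c) {y : ℝ}
    (hy : y < x) : ∃ v, y < v ∧ v < x ∧ F.law.real (Ici v) < c := by
  obtain ⟨w, hw, hw'⟩ := (((tendsto_real_Ioi F x).eventually (gt_mem_nhds h)).and
    (Ioo_mem_nhdsLT hy)).exists
  obtain ⟨v, hv⟩ := exists_between hw'.2
  exact ⟨v, hw'.1.trans hv.1, hv.2,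
    (measureReal_mono (Ici_subset_Ioi.2 hv.1)).trans_lt hw⟩

lemma Dominates.real_Ici_le (h : Dominates F₁ F₂) (x : ℝ) :
    F₂.law.real (Ici x) ≤ F₁.law.real (Ici x) := by
  refine le_of_tendsto_of_tendsto' (tendsto_real_Ioi F₂ x) (tendsto_real_Ioi F₁ x) fun v => ?_
  rw [real_Ioi, real_Ioi]
  linarith [h v]

lemma Dominates.measure_le_of_isUpperSet (h : Dominates F₁ F₂) {U : Set ℝ} (hU : IsUpperSet U) :
    F₂.law U ≤ F₁.law U := by
  rcases U.eq_empty_or_nonempty with rfl | hne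
  · simp
  by_cases hb : BddBelow U
  · have hsub : Ioi (sInf U) ⊆ U := fun y hy => by
      obtain ⟨z, hz, hzy⟩ := exists_lt_of_csInf_lt hne hy
      exact hU hzy.le hz
    by_cases hm : sInf U ∈ U
    · have : U = Ici (sInf U) :=
        Subset.antisymm (fun y hy => csInf_le hb hy) fun y hy => hU hy hm
      rw [this, ← ENNReal.toReal_le_toReal (measure_ne_top _ _) (measure_ne_top _ _)]
      exact h.real_Ici_le _
    · have : U = Ioi (sInf U) :=
        Subset.antisymm (fun y hy => lt_of_le_of_ne (csInf_le hb hy) fun e => hm (e ▸ hy)) hsub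
      rw [this, ← ENNReal.toReal_le_toReal (measure_ne_top _ _) (measure_ne_top _ _)]
      have h1 := real_Ioi F₁ (sInf U)
      have h2 := real_Ioi F₂ (sInf U)
      rw [measureReal_def] at h1 h2
      rw [h1, h2]
      linarith [h (sInf U)]
  · have : U = univ := by
      refine eq_univ_of_forall fun y => ?_
      obtain ⟨z, hz, hzy⟩ := not_bddBelow_iff.1 hb y
      exact hU hzy.le hz
    simp [this]

/-- First-order dominance raises the expectation of non-decreasing functions. -/
lemma Dominates.lintegral_le (h : Dominates F₁ F₂) (hg : Monotone g) :
    ∫⁻ s, ENNReal.ofReal (g s) ∂F₂.law ≤ ∫⁻ s, ENNReal.ofReal (g s) ∂F₁.law := by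
  have key : ∀ F : ValueDist, ∫⁻ s, ENNReal.ofReal (g s) ∂F.law
      = ∫⁻ t in Ioi (0 : ℝ), F.law {s | t < max (g s) 0} := fun F => by
    rw [← lintegral_eq_lintegral_meas_lt F.law (f := fun s => max (g s) 0)
      (Eventually.of_forall fun s => le_max_right _ _)
      (hg.measurable.max measurable_const).aemeasurable]
    simp [ENNReal.ofReal_max]
  rw [key, key]
  refine lintegral_mono fun t => h.measure_le_of_isUpperSet fun x y hxy hx => ?_
  exact lt_of_lt_of_le hx (max_le_max_right _ (hg hxy))

lemma extExp_of_ae_eq {Ω : Type*} [MeasurableSpace Ω] {μ : Measure Ω} [IsProbabilityMeasure μ]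
    {k : Ω → ℝ} {c : ℝ} (h : ∀ᵐ ω ∂μ, k ω = c) : extExp μ k = c := by
  have h1 : ∫⁻ ω, ENNReal.ofReal (k ω) ∂μ = ENNReal.ofReal c := by
    rw [lintegral_congr_ae (g := fun _ => ENNReal.ofReal c)
      (by filter_upwards [h] with ω hω; rw [hω])]
    simp
  have h2 : ∫⁻ ω, ENNReal.ofReal (-k ω) ∂μ = ENNReal.ofReal (-c) := by
    rw [lintegral_congr_ae (g := fun _ => ENNReal.ofReal (-c))
      (by filter_upwards [h] with ω hω; rw [hω])]
    simp
  rw [extExp, h1, h2, EReal.coe_ennreal_ofReal, EReal.coe_ennreal_ofReal, ← EReal.coe_sub]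
  congr 1
  rcases le_total 0 c with hc | hc
  · rw [max_eq_left hc, max_eq_right (by linarith), sub_zero]
  · rw [max_eq_right hc, max_eq_left (by linarith)]; ring

lemma lintegral_ofReal_neg (F : ValueDist) (hg : ∀ s, 0 ≤ s → 0 ≤ g s) :
    ∫⁻ s, ENNReal.ofReal (-g s) ∂F.law = 0 := by
  rw [← lintegral_zero (μ := F.law)]
  refine lintegral_congr_ae ?_
  filter_upwards [ae_nonneg F] with s hs
  exact ENNReal.ofReal_of_nonpos (by linarith [hg s hs])

lemma extExp_eq_lintegral (F : ValueDist) (hg : ∀ s, 0 ≤ s → 0 ≤ g s) :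
    extExp F.law g = ((∫⁻ s, ENNReal.ofReal (g s) ∂F.law : ℝ≥0∞) : EReal) := by
  rw [extExp, lintegral_ofReal_neg F hg]
  simp

lemma extExp_nonneg (F : ValueDist) (hg : ∀ s, 0 ≤ s → 0 ≤ g s) : 0 ≤ extExp F.law g := by
  rw [extExp_eq_lintegral F hg]
  exact EReal.coe_ennreal_nonneg _

lemma extExp_le_extExp {g' : ℝ → ℝ} (F : ValueDist) (hg : ∀ s, 0 ≤ s → 0 ≤ g s)
    (h : ∀ s, 0 ≤ s → g s ≤ g' s) : extExp F.law g ≤ extExp F.law g' := by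
  rw [extExp_eq_lintegral F hg, extExp_eq_lintegral F fun s hs => (hg s hs).trans (h s hs),
    EReal.coe_ennreal_le_coe_ennreal_iff]
  refine lintegral_mono_ae ?_
  filter_upwards [ae_nonneg F] with s hs using ENNReal.ofReal_le_ofReal (h s hs)

lemma Dominates.extExp_le (h : Dominates F₁ F₂) (hg : Monotone g) (hg0 : ∀ s, 0 ≤ s → 0 ≤ g s) :
    extExp F₂.law g ≤ extExp F₁.law g := by
  rw [extExp_eq_lintegral _ hg0, extExp_eq_lintegral _ hg0, EReal.coe_ennreal_le_coe_ennreal_iff]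
  exact h.lintegral_le hg

/-- Markov's inequality for a non-decreasing function. -/
lemma mul_real_Ici_le_extExp (F : ValueDist) (hg : Monotone g) (hg0 : ∀ s, 0 ≤ s → 0 ≤ g s)
    {x : ℝ} (hx : 0 ≤ x) : ((g x * F.law.real (Ici x) : ℝ) : EReal) ≤ extExp F.law g := by
  have h1 : ENNReal.ofReal (g x) * F.law (Ici x) ≤ ∫⁻ s, ENNReal.ofReal (g s) ∂F.law := by
    rw [← lintegral_indicator_const measurableSet_Ici]
    refine lintegral_mono fun s => ?_
    by_cases hs : s ∈ Ici x
    · simpa [hs] using ENNReal.ofReal_le_ofReal (hg hs)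
    · simp [hs]
  rw [extExp_eq_lintegral F hg0]
  refine le_trans (le_of_eq ?_) (EReal.coe_ennreal_le_coe_ennreal_iff.2 h1)
  rw [EReal.coe_ennreal_mul, EReal.coe_ennreal_ofReal, max_eq_left (hg0 x hx), EReal.coe_mul,
    measureReal_def, EReal.coe_ennreal_toReal (measure_ne_top _ _)]

end basics

/-! ### Approximately optimal prices -/

section prices

variable {F : ValueDist} {Γ R x p : ℝ}

lemma rev_le_opt (p : ℝ) (F : ValueDist) : (rev p F : EReal) ≤ opt F :=
  le_iSup (fun p : ℝ => (rev p F : EReal)) p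

lemma rev_nonneg (hp : 0 ≤ p) : 0 ≤ rev p F := mul_nonneg hp measureReal_nonneg

lemma rev_le_self (hp : 0 ≤ p) : rev p F ≤ p := mul_le_of_le_one_right hp measureReal_le_one

lemma rev_of_nonpos (hp : p ≤ 0) : rev p F = p := by
  rw [rev, real_Ici_of_nonpos F hp, mul_one]

lemma opt_nonneg (F : ValueDist) : 0 ≤ opt F := by
  refine le_trans ?_ (rev_le_opt 0 F)
  simp [rev]

lemma opt_le (h : ∀ p, rev p F ≤ R) : opt F ≤ R := iSup_le fun p => EReal.coe_le_coe_iff.2 (h p)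

lemma le_mul_opt (hΓ : 0 ≤ Γ) (hR : (R : EReal) ≤ opt F) : ((Γ * R : ℝ) : EReal) ≤ Γ * opt F := by
  rw [EReal.coe_mul]
  exact mul_le_mul_of_nonneg_left hR (EReal.coe_nonneg.2 hΓ)

lemma mul_opt_le (hΓ : 0 ≤ Γ) (hR : opt F ≤ R) : Γ * opt F ≤ ((Γ * R : ℝ) : EReal) := by
  rw [EReal.coe_mul]
  exact mul_le_mul_of_nonneg_left hR (EReal.coe_nonneg.2 hΓ)

lemma lowerPrice_le (h : (Γ : EReal) * opt F ≤ rev p F) : lowerPrice F Γ ≤ p :=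
  sInf_le ⟨p, h, rfl⟩

lemma le_upperPrice (h : (Γ : EReal) * opt F ≤ rev p F) : (p : EReal) ≤ upperPrice F Γ :=
  le_sSup ⟨p, h, rfl⟩

lemma le_lowerPrice (hΓ : 0 ≤ Γ) (hR : (R : EReal) ≤ opt F) (h : ∀ p < x, rev p F < Γ * R) :
    (x : EReal) ≤ lowerPrice F Γ := by
  refine le_sInf ?_
  rintro _ ⟨p, hp, rfl⟩
  refine EReal.coe_le_coe_iff.2 (not_lt.1 fun hlt => ?_)
  have := EReal.coe_le_coe_iff.1 ((le_mul_opt hΓ hR).trans hp)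
  exact absurd (h p hlt) (not_lt.2 this)

lemma upperPrice_le (hΓ : 0 ≤ Γ) (hR : (R : EReal) ≤ opt F) (h : ∀ p > x, rev p F < Γ * R) :
    upperPrice F Γ ≤ x := by
  refine sSup_le ?_
  rintro _ ⟨p, hp, rfl⟩
  refine EReal.coe_le_coe_iff.2 (not_lt.1 fun hlt => ?_)
  have := EReal.coe_le_coe_iff.1 ((le_mul_opt hΓ hR).trans hp)
  exact absurd (h p hlt) (not_lt.2 this)

end prices

/-! ### Minimal and maximal distributions -/

section extremal

variable {α : Icc (0 : ℝ) 1} {l a b : ℝ≥0} {Γ p : ℝ}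

lemma minimalDist_real_Ici (hp0 : 0 ≤ p) (hp : p ≤ a) :
    (minimalDist α l a).law.real (Ici p) = survE α (l * p) := by
  rcases hp0.eq_or_lt with rfl | h0
  · simp [real_Ici_of_nonpos, survE_zero]
  · refine real_Ici_eq_of_tendsto (S := fun v => survE α (l * v)) ?_ ?_
    · filter_upwards [Ioo_mem_nhdsLT h0] with v hv
      rw [real_Ioi, minimalDist_cdf, if_neg (not_lt.2 hv.1.le), if_pos (hv.2.trans_le hp)]
      ring
    · have h1 : ContinuousAt (survE α) (l * p) :=
        (hasDerivAt_survE (one_add_mul_pos α.2.2 (by positivity))).continuousAt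
      exact tendsto_nhdsWithin_of_tendsto_nhds
        (ContinuousAt.tendsto (f := fun v : ℝ => survE α (l * v))
          (ContinuousAt.comp (g := survE α) h1 (by fun_prop)))

lemma minimalDist_real_Ioi_self : (minimalDist α l a).law.real (Ioi (a : ℝ)) = 0 := by
  rw [real_Ioi, minimalDist_cdf, if_neg (not_lt.2 a.coe_nonneg), if_neg (lt_irrefl _), sub_self]

lemma minimalDist_real_Ici_of_lt (hp : (a : ℝ) < p) : (minimalDist α l a).law.real (Ici p) = 0 :=
  le_antisymm ((measureReal_mono (Ici_subset_Ioi.2 hp)).trans minimalDist_real_Ioi_self.le)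
    measureReal_nonneg

lemma minimalDist_ae_le : ∀ᵐ s : ℝ ∂(minimalDist α l a).law, s ≤ a := by
  have := (measureReal_eq_zero_iff (measure_ne_top _ _)).1
    (minimalDist_real_Ioi_self (α := α) (l := l) (a := a))
  rw [ae_iff]
  convert this using 2
  ext s
  simp

lemma rev_minimalDist (hp0 : 0 ≤ p) (hp : p ≤ a) :
    rev p (minimalDist α l a) = p * survE α (l * p) := by
  rw [rev, minimalDist_real_Ici hp0 hp]

lemma mul_survE_mul_mono {α l y z : ℝ} (hα0 : 0 ≤ α) (hα : α ≤ 1) (hl : 0 ≤ l) (hy : 0 ≤ y)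
    (hyz : y ≤ z) (hz : α * l * z ≤ 1) : y * survE α (l * y) ≤ z * survE α (l * z) := by
  rcases hl.eq_or_lt with rfl | hl
  · simpa [survE_zero] using hyz
  · have := mul_survE_mono (α := α) (β := 0) (y := l * y) (z := l * z) hα0 hα
      (by rw [sub_zero]; exact one_add_mul_pos hα (by positivity)) (by gcongr) (by linarith)
    simp only [sub_zero, mul_assoc] at this
    exact le_of_mul_le_mul_left this hl

lemma rev_minimalDist_mono (h : (α : ℝ) * l * a ≤ 1) {q : ℝ} (hpq : p ≤ q) (hq : q ≤ a) :
    rev p (minimalDist α l a) ≤ rev q (minimalDist α l a) := by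
  rcases le_total q 0 with hq0 | hq0
  · rwa [rev_of_nonpos (hpq.trans hq0), rev_of_nonpos hq0]
  · rcases le_total p 0 with hp0 | hp0
    · rw [rev_of_nonpos hp0]; exact hp0.trans (rev_nonneg hq0)
    · rw [rev_minimalDist hp0 (hpq.trans hq), rev_minimalDist hq0 hq]
      refine mul_survE_mul_mono α.2.1 α.2.2 l.2 hp0 hpq (le_trans ?_ h)
      exact mul_le_mul_of_nonneg_left hq (mul_nonneg α.2.1 l.2)

/-- The condition `α l a ≤ 1` makes the atom `a` an optimal price. -/
lemma opt_minimalDist (h : (α : ℝ) * l * a ≤ 1) :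
    opt (minimalDist α l a) = (rev a (minimalDist α l a) : ℝ) := by
  refine le_antisymm (opt_le fun p => ?_) (rev_le_opt _ _)
  rcases le_or_gt p a with hp | hp
  · exact rev_minimalDist_mono h hp le_rfl
  · rw [rev, minimalDist_real_Ici_of_lt hp, mul_zero]
    exact rev_nonneg a.2

lemma lowerPrice_minimalDist_le (hΓ : 0 ≤ Γ) (hΓ1 : Γ ≤ 1) (h : (α : ℝ) * l * a ≤ 1) :
    lowerPrice (minimalDist α l a) Γ ≤ (a : ℝ) := by
  refine lowerPrice_le ((mul_opt_le hΓ (opt_minimalDist h).le).trans ?_)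
  exact EReal.coe_le_coe_iff.2 (mul_le_of_le_one_left (rev_nonneg a.2) hΓ1)

lemma pointMass_ae_eq : ∀ᵐ s : ℝ ∂(minimalDist α 0 a).law, s = a := by
  have h1 : ∀ᵐ s : ℝ ∂(minimalDist α 0 a).law, (a : ℝ) ≤ s := by
    have h2 := minimalDist_real_Ici (α := α) (l := 0) (a := a) a.2 le_rfl
    rw [NNReal.coe_zero, zero_mul, survE_zero] at h2
    exact (mem_ae_iff_prob_eq_one measurableSet_Ici).2
      ((ENNReal.toReal_eq_one_iff _).1 h2)
  filter_upwards [h1, minimalDist_ae_le] with s hs hs' using le_antisymm hs' hs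

lemma extExp_pointMass (g : ℝ → ℝ) : extExp (minimalDist α 0 a).law g = (g a : ℝ) :=
  extExp_of_ae_eq (by filter_upwards [pointMass_ae_eq] with s hs; rw [hs])

lemma maximalDist_pos (hlb : 1 ≤ l * b) : (0 : ℝ) < l ∧ (0 : ℝ) < b := by
  have h : (1 : ℝ) ≤ l * b := by exact_mod_cast hlb
  constructor
  · rcases l.2.eq_or_lt with h0 | h0
    · simp only [NNReal.val_eq_coe] at h0; rw [← h0] at h; linarith
    · exact h0
  · rcases b.2.eq_or_lt with h0 | h0
    · simp only [NNReal.val_eq_coe] at h0; rw [← h0] at h; linarith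
    · exact h0

lemma maximalDist_real_Ioi (hlb : 1 ≤ l * b) (hp : b ≤ p) :
    (maximalDist α l b hlb).law.real (Ioi p) = survE α (l * (p - b)) := by
  rw [real_Ioi, maximalDist_cdf, if_neg (not_lt.2 hp)]
  ring

lemma maximalDist_real_Ici (hlb : 1 ≤ l * b) (hp : b ≤ p) :
    (maximalDist α l b hlb).law.real (Ici p) = survE α (l * (p - b)) := by
  rcases hp.eq_or_lt with rfl | h0
  · rw [sub_self, mul_zero, survE_zero]
    refine real_Ici_eq_of_tendsto (S := fun v => 1) ?_ tendsto_const_nhds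
    filter_upwards [self_mem_nhdsWithin] with v hv
    rw [real_Ioi, maximalDist_cdf, if_pos (show v < b from hv), sub_zero]
  · refine real_Ici_eq_of_tendsto (S := fun v => survE α (l * (v - b))) ?_ ?_
    · filter_upwards [Ioo_mem_nhdsLT h0] with v hv
      exact maximalDist_real_Ioi hlb hv.1.le
    · have h1 : ContinuousAt (survE α) (l * (p - b)) :=
        (hasDerivAt_survE (one_add_mul_pos α.2.2
          (mul_nonneg l.2 (sub_nonneg.2 hp)))).continuousAt
      exact tendsto_nhdsWithin_of_tendsto_nhds
        (ContinuousAt.tendsto (f := fun v : ℝ => survE α (l * (v - b)))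
          (ContinuousAt.comp (g := survE α) h1 (by fun_prop)))

lemma rev_maximalDist (hlb : 1 ≤ l * b) (hp : b ≤ p) :
    rev p (maximalDist α l b hlb) = p * survE α (l * (p - b)) := by
  rw [rev, maximalDist_real_Ici hlb hp]

lemma rev_maximalDist_self (hlb : 1 ≤ l * b) : rev b (maximalDist α l b hlb) = b := by
  rw [rev_maximalDist hlb le_rfl, sub_self, mul_zero, survE_zero, mul_one]

/-- The condition `l b ≥ 1` makes revenue non-increasing above the lower end `b` of the support. -/
lemma rev_maximalDist_anti (hlb : 1 ≤ l * b) {q : ℝ} (hp : b ≤ p) (hpq : p ≤ q) :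
    rev q (maximalDist α l b hlb) ≤ rev p (maximalDist α l b hlb) := by
  have hl := (maximalDist_pos hlb).1
  have hα0 : (0 : ℝ) ≤ α := α.2.1
  have h : (1 : ℝ) ≤ l * b := by exact_mod_cast hlb
  rw [rev_maximalDist hlb hp, rev_maximalDist hlb (hp.trans hpq)]
  have hbp : (l : ℝ) * b ≤ l * p := by gcongr
  have := mul_survE_anti (α := α) (β := l * b) (y := l * p) (z := l * q) α.2.1 α.2.2
    (one_add_mul_pos α.2.2 (by linarith)) (by gcongr)
    (by nlinarith [mul_le_mul_of_nonneg_left hbp hα0])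
  simp only [mul_assoc, ← mul_sub] at this
  exact le_of_mul_le_mul_left this hl

lemma rev_maximalDist_le (hlb : 1 ≤ l * b) (p : ℝ) : rev p (maximalDist α l b hlb) ≤ b := by
  rcases le_total p b with hp | hp
  · rcases le_total p 0 with h0 | h0
    · rw [rev_of_nonpos h0]; exact hp
    · exact (rev_le_self h0).trans hp
  · exact (rev_maximalDist_anti hlb le_rfl hp).trans (rev_maximalDist_self hlb).le

lemma opt_maximalDist (hlb : 1 ≤ l * b) : opt (maximalDist α l b hlb) = (b : ℝ) :=
  le_antisymm (opt_le (rev_maximalDist_le hlb))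
    ((EReal.coe_le_coe_iff.2 (rev_maximalDist_self hlb).ge).trans (rev_le_opt _ _))

/-- A single price at which the revenue has dropped below `Γ b` bounds all `Γ`-approximate
prices. -/
lemma upperPrice_maximalDist_le (hlb : 1 ≤ l * b) {x : ℝ} (hΓ : 0 ≤ Γ) (hx : b ≤ x)
    (h : x * survE α (l * (x - b)) < Γ * b) : upperPrice (maximalDist α l b hlb) Γ ≤ x := by
  refine upperPrice_le hΓ (opt_maximalDist hlb).ge fun p hp => ?_
  refine (rev_maximalDist_anti hlb hx hp.le).trans_lt ?_
  rwa [rev_maximalDist hlb hx]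

end extremal

/-! ### Revenue of a hidden pricing mechanism -/

section revenue

variable {h : ℝ → ValueDist → ℝ} {F : ValueDist}

lemma revenue_hiddenMechanism (hm : Measurable fun s => h s F)
    (h0 : ∀ s, 0 ≤ s → 0 ≤ h s F) : (hiddenMechanism h).revenue F
      = ((F.law {v : ℝ | policy h F ≤ v} * ∫⁻ s, ENNReal.ofReal (h s F) ∂F.law : ℝ≥0∞) : EReal) := by
  have hA : MeasurableSet {v : ℝ | policy h F ≤ v} :=
    measurableSet_le measurable_const measurable_coe_real_ereal
  have h1 : ∫⁻ z, ENNReal.ofReal ((hiddenMechanism h).pay z.1 z.2 F) ∂(F.law.prod F.law)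
      = F.law {v : ℝ | policy h F ≤ v} * ∫⁻ s, ENNReal.ofReal (h s F) ∂F.law := by
    rw [mul_comm, ← lintegral_indicator_one hA,
      ← lintegral_prod_mul hm.ennreal_ofReal.aemeasurable
        (measurable_one.indicator hA).aemeasurable]
    refine lintegral_congr fun z => ?_
    by_cases hz : policy h F ≤ z.2 <;> simp [hiddenMechanism, hz]
  have h2 : ∫⁻ z, ENNReal.ofReal (-(hiddenMechanism h).pay z.1 z.2 F) ∂(F.law.prod F.law) = 0 := by
    rw [← lintegral_zero (μ := F.law.prod F.law)]
    refine lintegral_congr_ae ?_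
    filter_upwards [Measure.quasiMeasurePreserving_fst.ae (ae_nonneg F)] with z hz
    refine ENNReal.ofReal_of_nonpos ?_
    by_cases hz' : policy h F ≤ z.2 <;> simp [hiddenMechanism, hz', h0 z.1 hz]
  rw [Mechanism.revenue, extExp, h1, h2]
  simp

lemma revenue_of_policy_eq_coe (hm : Measurable fun s => h s F)
    (h0 : ∀ s, 0 ≤ s → 0 ≤ h s F) {p : ℝ} (hp : policy h F = p) :
    (hiddenMechanism h).revenue F = (rev p F : ℝ) := by
  rw [revenue_hiddenMechanism hm h0, EReal.coe_ennreal_mul, ← extExp_eq_lintegral F h0]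
  change _ * policy h F = _
  rw [hp, rev, EReal.coe_mul, mul_comm]
  congr 1
  simp only [EReal.coe_le_coe_iff]
  rw [measureReal_def, EReal.coe_ennreal_toReal (measure_ne_top _ _)]
  rfl

lemma revenue_of_policy_eq_top (hm : Measurable fun s => h s F)
    (h0 : ∀ s, 0 ≤ s → 0 ≤ h s F) (hp : policy h F = ⊤) :
    (hiddenMechanism h).revenue F = 0 := by
  rw [revenue_hiddenMechanism hm h0, hp]
  simp

end revenue

/-! ### Supporting lines of regular distributions -/

section regular

/-- A comparison principle: if `(c - ∫ f) G' ≤ f G`, then the product `(c - ∫ f) G`, whose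
derivative is `(c - ∫ f) G' - f G` almost everywhere, does not increase. -/
lemma mul_le_of_deriv_le {f G G' : ℝ → ℝ} {p q c : ℝ} (hpq : p ≤ q)
    (hf : IntervalIntegrable f volume p q) (hG : ∀ x ∈ Icc p q, HasDerivAt G (G' x) x)
    (hGc : ContDiffOn ℝ 1 G (Icc p q))
    (h : ∀ x ∈ Ioo p q, (c - ∫ t in p..x, f t) * G' x ≤ f x * G x) :
    (c - ∫ t in p..q, f t) * G q ≤ c * G p := by
  have hS : AbsolutelyContinuousOnInterval (fun x => c - ∫ t in p..x, f t) p q := by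
    have h0 : AbsolutelyContinuousOnInterval (fun _ : ℝ => c) p q :=
      (contDiff_const (n := 1)).contDiffOn.absolutelyContinuousOnInterval
    exact h0.sub (hf.absolutelyContinuousOnInterval_intervalIntegral left_mem_uIcc)
  have hG1 : AbsolutelyContinuousOnInterval G p q :=
    ContDiffOn.absolutelyContinuousOnInterval (by rwa [uIcc_of_le hpq])
  have key := hS.integral_deriv_mul_eq_sub hG1
  have hle : ∫ x in p..q, (deriv (fun x => c - ∫ t in p..x, f t) x * G x
      + (c - ∫ t in p..x, f t) * deriv G x) ≤ 0 := by
    rw [intervalIntegral.integral_of_le hpq, integral_Ioc_eq_integral_Ioo]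
    refine setIntegral_nonpos_ae measurableSet_Ioo ?_
    filter_upwards [hf.ae_hasDerivAt_integral] with x hx hxI
    have hxI' : x ∈ uIcc p q := by rw [uIcc_of_le hpq]; exact Ioo_subset_Icc_self hxI
    rw [((hx hxI' p left_mem_uIcc).const_sub c).deriv, (hG x (Ioo_subset_Icc_self hxI)).deriv]
    linarith [h x hxI]
  rw [key] at hle
  simp only [intervalIntegral.integral_same, sub_zero] at hle
  linarith

lemma le_mul_of_le_deriv {f G G' : ℝ → ℝ} {p q c : ℝ} (hpq : p ≤ q)
    (hf : IntervalIntegrable f volume p q) (hG : ∀ x ∈ Icc p q, HasDerivAt G (G' x) x)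
    (hGc : ContDiffOn ℝ 1 G (Icc p q))
    (h : ∀ x ∈ Ioo p q, f x * G x ≤ (c - ∫ t in p..x, f t) * G' x) :
    c * G p ≤ (c - ∫ t in p..q, f t) * G q := by
  have := mul_le_of_deriv_le (f := fun x => -f x) (G := G) (G' := G') (c := -c) hpq hf.neg hG hGc
    (fun x hx => by rw [intervalIntegral.integral_neg]; linarith [h x hx])
  rw [intervalIntegral.integral_neg] at this
  linarith

lemma cdf_mono (F : ValueDist) {v w : ℝ} (h : v ≤ w) : F.cdf v ≤ F.cdf w :=
  measureReal_mono (Iic_subset_Iic.2 h)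

lemma cdf_le_one (F : ValueDist) (v : ℝ) : F.cdf v ≤ 1 := measureReal_le_one

/-- A density in the sense of the regularity condition integrates to differences of survival
probabilities. -/
lemma real_Ioi_eq_sub_integral {F : ValueDist} {f : ℝ → ℝ≥0} (hf : Measurable f)
    (hd : ∀ v : ℝ, F.cdf v < 1 → F.law (Iic v) = ∫⁻ x in Iic v, (f x : ℝ≥0∞)) {p q : ℝ}
    (hpq : p ≤ q) (hq : F.cdf q < 1) :
    IntervalIntegrable (fun x => (f x : ℝ)) volume p q ∧
      F.law.real (Ioi q) = F.law.real (Ioi p) - ∫ t in p..q, (f t : ℝ) := by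
  have hI : ∀ v, F.cdf v < 1 → IntegrableOn (fun x => (f x : ℝ)) (Iic v) := fun v hv => by
    refine ⟨(measurable_coe_nnreal_real.comp hf).aestronglyMeasurable, ?_⟩
    rw [hasFiniteIntegral_iff_enorm]
    simp only [Real.enorm_eq_ofReal (NNReal.coe_nonneg _), ENNReal.ofReal_coe_nnreal]
    rw [← hd v hv]
    exact measure_lt_top _ _
  have hc : ∀ v, F.cdf v < 1 → F.cdf v = ∫ x in Iic v, (f x : ℝ) := fun v hv => by
    rw [integral_eq_lintegral_of_nonneg_ae (Eventually.of_forall fun x => NNReal.coe_nonneg _)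
      (measurable_coe_nnreal_real.comp hf).aestronglyMeasurable]
    simp only [ENNReal.ofReal_coe_nnreal]
    rw [← hd v hv]
    rfl
  have hp : F.cdf p < 1 := (cdf_mono F hpq).trans_lt hq
  refine ⟨(intervalIntegrable_iff_integrableOn_Ioc_of_le hpq).2
    ((hI q hq).mono_set Ioc_subset_Iic_self), ?_⟩
  rw [← intervalIntegral.integral_Iic_sub_Iic (hI p hp) (hI q hq), ← hc p hp, ← hc q hq,
    real_Ioi, real_Ioi]
  ring

/-- Regularity as a supporting-line property. Writing the survival function as `E ∘ W`, a regular
distribution has a convex `W`; the line `w + l (v - x)` supports `W` at `x`, so the survival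
function lies below the one obtained from the positive part of this line, with equality
at `x`. -/
lemma IsRegular.exists_supporting_line {α : Icc (0 : ℝ) 1} {F : ValueDist} (hF : IsRegular α F)
    {x : ℝ} (hx : F.cdf x < 1) : ∃ w l : ℝ, 0 ≤ w ∧ 0 ≤ l ∧ survE α w = F.law.real (Ioi x) ∧
      w ≤ l * x ∧ ∀ v, F.law.real (Ioi v) ≤ survE α (max (w + l * (v - x)) 0) := by
  obtain ⟨f, hf, hd, hmono⟩ := hF
  have hα : (α : ℝ) ≤ 1 := α.2.2
  have hS0 : 0 < F.law.real (Ioi x) := by rw [real_Ioi]; linarith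
  -- The bound on the survival function at negative arguments, where it equals one, places the
  -- zero of the line to the right of the origin.
  suffices hmain : ∃ w l : ℝ, 0 ≤ w ∧ 0 ≤ l ∧ survE α w = F.law.real (Ioi x) ∧
      ∀ v, F.law.real (Ioi v) ≤ survE α (max (w + l * (v - x)) 0) by
    obtain ⟨w, l, hw, hl, hwx, hv⟩ := hmain
    refine ⟨w, l, hw, hl, hwx, ?_, hv⟩
    have h1 : ∀ v < 0, w + l * (v - x) ≤ 0 := fun v hv0 => by
      have h2 := hv v
      rw [real_Ioi_of_neg F hv0] at h2
      exact (le_max_left _ _).trans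
        ((survE_le_iff hα le_rfl (le_max_right _ _)).1 ((survE_zero α).le.trans h2))
    have h3 : Tendsto (fun v : ℝ => w + l * (v - x)) (𝓝[<] 0) (𝓝 (w + l * (0 - x))) :=
      tendsto_nhdsWithin_of_tendsto_nhds (Continuous.tendsto (by fun_prop) 0)
    have h4 := le_of_tendsto h3 (by filter_upwards [self_mem_nhdsWithin] with v hv0 using h1 v hv0)
    linarith
  by_cases hfx : f x = 0
  · -- A vanishing density at `x` forces a vanishing density below `x`.
    have h1 : ∀ t ≤ x, f t = 0 := fun t ht => by
      by_contra hne
      have h2 := hmono (show F.cdf t < 1 from (cdf_mono F ht).trans_lt hx) hx ht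
      rw [virtualValue, virtualValue, if_pos hfx, if_neg hne, le_bot_iff] at h2
      exact EReal.coe_ne_bot _ h2
    have h3 : F.cdf x = 0 := by
      have : F.law (Iic x) = 0 := by
        rw [hd x hx, ← lintegral_zero (μ := volume.restrict (Iic x))]
        exact setLIntegral_congr_fun measurableSet_Iic fun t ht => by simp [h1 t ht]
      rw [ValueDist.cdf, measureReal_def, this]
      rfl
    refine ⟨0, 0, le_rfl, le_rfl, by rw [survE_zero, real_Ioi, h3, sub_zero], fun v => ?_⟩
    simp [survE_zero]
  · have hfx0 : (0 : ℝ) < f x := NNReal.coe_pos.2 (pos_iff_ne_zero.2 hfx)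
    obtain ⟨w, hw, hwx⟩ := exists_survE_eq hα hS0 measureReal_le_one
    set κ : ℝ := F.law.real (Ioi x) / f x with hκ
    have hκ0 : 0 < κ := div_pos hS0 hfx0
    set l : ℝ := (1 + (1 - α) * w) / κ with hl
    have hl0 : 0 < l := div_pos (one_add_mul_pos hα hw) hκ0
    -- `D v` is `1 + (1 - α) L(v)` for the line `L`, and `l` times the inverse hazard rate that
    -- `E ∘ L` has at `v`.
    have hD : ∀ v, 1 + (1 - (α : ℝ)) * (w + l * (v - x)) = l * (κ + (1 - α) * (v - x)) := fun v => by
      have : l * κ = 1 + (1 - α) * w := div_mul_cancel₀ _ hκ0.ne'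
      linear_combination -this
    have hφ : virtualValue α F f x = (((1 - α) * x - κ : ℝ) : EReal) := by
      rw [virtualValue, if_neg hfx, hκ, real_Ioi]
    have hG : ∀ v, 0 < 1 + (1 - (α : ℝ)) * (w + l * (v - x)) →
        HasDerivAt (fun v => (survE α (w + l * (v - x)))⁻¹)
          ((survE α (w + l * (v - x)))⁻¹ * (κ + (1 - α) * (v - x))⁻¹) v ∧
        ContDiffAt ℝ 1 (fun v => (survE α (w + l * (v - x)))⁻¹) v := fun v hv => by
      have hE := (survE_pos hv).ne'
      constructor
      · have h1 : HasDerivAt (fun v : ℝ => w + l * (v - x)) l v := by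
          simpa using (((hasDerivAt_id v).sub_const x).const_mul l).const_add w
        have h2 : HasDerivAt (fun v => survE α (w + l * (v - x)))
            (-survE α (w + l * (v - x)) / (1 + (1 - α) * (w + l * (v - x))) * l) v :=
          HasDerivAt.comp (h₂ := survE α) v (hasDerivAt_survE hv) h1
        refine (h2.fun_inv hE).congr_deriv ?_
        have h3 : κ + (1 - α) * (v - x) ≠ 0 := by
          intro h0; rw [hD, h0, mul_zero] at hv; exact lt_irrefl _ hv
        rw [hD]
        field_simp
      · exact ContDiffAt.inv (ContDiffAt.comp (g := survE α) v (contDiffAt_survE hv)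
          (by fun_prop)) hE
    refine ⟨w, l, hw, hl0.le, hwx, fun v => ?_⟩
    rcases le_or_gt 1 (F.cdf v) with hv1 | hv1
    · rw [real_Ioi]
      exact (by linarith : 1 - F.cdf v ≤ 0).trans (survE_nonneg hα (le_max_right _ _))
    rcases le_total (w + l * (v - x)) 0 with hL | hL
    · rw [max_eq_right hL, survE_zero]; exact measureReal_le_one
    rw [max_eq_left hL]
    have hDpos : ∀ t, 0 ≤ w + l * (t - x) → 0 < 1 + (1 - (α : ℝ)) * (w + l * (t - x)) :=
      fun t ht => one_add_mul_pos hα ht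
    have hκpos : ∀ t, 0 ≤ w + l * (t - x) → 0 < κ + (1 - (α : ℝ)) * (t - x) := fun t ht => by
      have := hDpos t ht
      rw [hD] at this
      exact (mul_pos_iff_of_pos_left hl0).1 this
    have hGx : (survE α (w + l * (x - x)))⁻¹ = (F.law.real (Ioi x))⁻¹ := by
      rw [sub_self, mul_zero, add_zero, hwx]
    have hEv : 0 < survE α (w + l * (v - x)) := survE_pos (hDpos v hL)
    rcases le_total x v with hxv | hvx
    · have hL' : ∀ t ∈ Icc x v, 0 ≤ w + l * (t - x) := fun t ht =>
        add_nonneg hw (mul_nonneg hl0.le (sub_nonneg.2 ht.1))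
      obtain ⟨hint, hSv⟩ := real_Ioi_eq_sub_integral hf hd hxv hv1
      have := mul_le_of_deriv_le (c := F.law.real (Ioi x)) hxv hint
        (fun t ht => (hG t (hDpos t (hL' t ht))).1)
        (fun t ht => (hG t (hDpos t (hL' t ht))).2.contDiffWithinAt) (fun t ht => by
          have ht' := Ioo_subset_Icc_self ht
          have ht1 : F.cdf t < 1 := (cdf_mono F ht.2.le).trans_lt hv1
          rw [← (real_Ioi_eq_sub_integral hf hd ht.1.le ht1).2]
          have h2 := hmono hx ht1 ht.1.le
          rw [hφ, virtualValue] at h2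
          split_ifs at h2 with h3
          · exact absurd (le_bot_iff.1 h2) (EReal.coe_ne_bot _)
          have h4 := EReal.coe_le_coe_iff.1 h2
          rw [← real_Ioi] at h4
          have hft : (0 : ℝ) < f t := NNReal.coe_pos.2 (pos_iff_ne_zero.2 h3)
          have h5 : F.law.real (Ioi t) / f t ≤ κ + (1 - α) * (t - x) := by linarith
          rw [div_le_iff₀ hft] at h5
          rw [mul_left_comm, mul_comm (f t : ℝ), ← div_eq_mul_inv (F.law.real (Ioi t))]
          refine mul_le_mul_of_nonneg_left ?_
            (inv_nonneg.2 (survE_pos (hDpos t (hL' t ht'))).le)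
          rw [div_le_iff₀ (hκpos t (hL' t ht'))]
          linarith)
      rw [← hSv, hGx, mul_inv_cancel₀ hS0.ne', ← div_eq_mul_inv, div_le_one hEv] at this
      exact this
    · have hL' : ∀ t ∈ Icc v x, 0 ≤ w + l * (t - x) := fun t ht => by
        have : l * (v - x) ≤ l * (t - x) := by
          refine mul_le_mul_of_nonneg_left ?_ hl0.le
          linarith [ht.1]
        linarith
      obtain ⟨hint, hSv⟩ := real_Ioi_eq_sub_integral hf hd hvx hx
      have := le_mul_of_le_deriv (c := F.law.real (Ioi v)) hvx hint
        (fun t ht => (hG t (hDpos t (hL' t ht))).1)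
        (fun t ht => (hG t (hDpos t (hL' t ht))).2.contDiffWithinAt) (fun t ht => by
          have ht' := Ioo_subset_Icc_self ht
          have ht1 : F.cdf t < 1 := (cdf_mono F ht.2.le).trans_lt hx
          rw [← (real_Ioi_eq_sub_integral hf hd ht.1.le ht1).2]
          have h2 := hmono ht1 hx ht.2.le
          have h5 : (f t : ℝ) * (κ + (1 - α) * (t - x)) ≤ F.law.real (Ioi t) := by
            rw [hφ, virtualValue] at h2
            split_ifs at h2 with h3
            · rw [h3, NNReal.coe_zero, zero_mul]; exact measureReal_nonneg
            have h4 := EReal.coe_le_coe_iff.1 h2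
            rw [← real_Ioi] at h4
            have hft : (0 : ℝ) < f t := NNReal.coe_pos.2 (pos_iff_ne_zero.2 h3)
            have h6 : κ + (1 - α) * (t - x) ≤ F.law.real (Ioi t) / f t := by linarith
            rw [le_div_iff₀ hft] at h6
            linarith
          rw [mul_left_comm, mul_comm (f t : ℝ), ← div_eq_mul_inv (F.law.real (Ioi t))]
          refine mul_le_mul_of_nonneg_left ?_
            (inv_nonneg.2 (survE_pos (hDpos t (hL' t ht'))).le)
          rwa [le_div_iff₀ (hκpos t (hL' t ht'))])
      rw [← hSv, hGx, mul_inv_cancel₀ hS0.ne', ← div_eq_mul_inv, div_le_one hEv] at this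
      exact this

end regular

/-! ### Comparison of regular distributions with minimal and maximal ones -/

section comparison

variable {α : Icc (0 : ℝ) 1} {F : ValueDist} {a x Γ : ℝ}

lemma cdf_lt_one_of_lt {v : ℝ} (hva : v < a) (h : 0 < F.law.real (Ici a)) : F.cdf v < 1 := by
  have := measureReal_mono (μ := F.law) (Ici_subset_Ioi.2 hva)
  rw [real_Ioi] at this
  linarith

lemma exists_line_through {v : ℝ} (α : Icc (0 : ℝ) 1) (hv : 0 < v) (h : 0 < F.law.real (Ici v)) :
    ∃ l : ℝ, 0 ≤ l ∧ F.law.real (Ici v) = survE α (l * v) := by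
  obtain ⟨w, hw, h1⟩ := exists_survE_eq α.2.2 h measureReal_le_one
  exact ⟨w / v, by positivity, by rw [div_mul_cancel₀ _ hv.ne', h1]⟩

/-- The chord inequality: below `a`, the survival function of a regular distribution lies above
the generalized Pareto one that agrees with it at `a`. -/
lemma IsRegular.survE_le_real_Ioi (hF : IsRegular α F) {l v : ℝ} (hl : 0 ≤ l)
    (h : F.law.real (Ici a) = survE α (l * a)) (hv : 0 ≤ v) (hva : v < a) :
    survE α (l * v) ≤ F.law.real (Ioi v) := by
  have hα : (α : ℝ) ≤ 1 := α.2.2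
  have ha : 0 < a := hv.trans_lt hva
  have hpos : 0 < F.law.real (Ici a) := by
    rw [h]; exact survE_pos (one_add_mul_pos hα (by positivity))
  obtain ⟨w, m, hw, hm, hwv, hwm, hline⟩ := hF.exists_supporting_line (cdf_lt_one_of_lt hva hpos)
  have h1 : F.law.real (Ici a) ≤ survE α (max (w + m * (a - v)) 0) := by
    refine le_of_tendsto_of_tendsto' (tendsto_real_Ioi F a) ?_ hline
    exact tendsto_nhdsWithin_of_tendsto_nhds (Continuous.tendsto
      (survE_continuous hα (g := fun y => max (w + m * (y - v)) 0) (by fun_prop)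
        fun _ => le_max_right _ _) a)
  rw [h, survE_le_iff hα (by positivity) (le_max_right _ _)] at h1
  have h2 : w + m * (a - v) ≤ l * a := (le_max_left _ _).trans h1
  rw [← hwv, survE_le_iff hα (by positivity) hw]
  have h3 : w * a ≤ (l * v) * a := by
    have := mul_le_mul_of_nonneg_left h2 hv
    nlinarith [mul_le_mul_of_nonneg_right hwm (sub_nonneg.2 hva.le)]
  exact le_of_mul_le_mul_right h3 ha

lemma IsRegular.tendsto_rev (hF : IsRegular α F) (hα0 : (0 : ℝ) < α) :
    Tendsto (fun p => rev p F) atTop (𝓝 0) := by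
  have hα : (α : ℝ) ≤ 1 := α.2.2
  have h0 : ∃ v : ℝ, 0 < v ∧ F.law.real (Ici v) < 1 := by
    obtain ⟨v, hv, hv0⟩ := (((ProbabilityTheory.tendsto_cdf_atTop F.law).eventually
      (lt_mem_nhds (zero_lt_one' ℝ))).and (eventually_gt_atTop 0)).exists
    refine ⟨v + 1, by linarith, ?_⟩
    rw [ProbabilityTheory.cdf_eq_real] at hv
    have h1 := real_Ioi F v
    have h2 := measureReal_mono (μ := F.law) (Ici_subset_Ioi.2 (lt_add_one v))
    have h3 : F.cdf v = F.law.real (Iic v) := rfl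
    linarith
  obtain ⟨v, hv, hv1⟩ := h0
  rcases (measureReal_nonneg (μ := F.law) (s := Ici v)).eq_or_lt with h1 | h1
  · refine tendsto_const_nhds.congr' ?_
    filter_upwards [eventually_ge_atTop v] with p hp
    have : F.law.real (Ici p) = 0 :=
      le_antisymm ((real_Ici_anti F hp).trans h1.ge) measureReal_nonneg
    rw [rev, this, mul_zero]
  · obtain ⟨l, hl, hlv⟩ := exists_line_through α hv h1
    have hl0 : 0 < l := by
      rcases hl.eq_or_lt with rfl | h2
      · rw [zero_mul, survE_zero] at hlv; exact absurd hlv hv1.ne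
      · exact h2
    refine squeeze_zero' ?_ ?_ (tendsto_mul_survE hα0 hα hl0)
    · filter_upwards [eventually_ge_atTop 0] with p hp using rev_nonneg hp
    · filter_upwards [eventually_gt_atTop v] with p hp
      have hp0 : 0 < p := hv.trans hp
      refine mul_le_mul_of_nonneg_left ?_ hp0.le
      rcases (measureReal_nonneg (μ := F.law) (s := Ici p)).eq_or_lt with h2 | h2
      · rw [← h2]; exact survE_nonneg hα (by positivity)
      · obtain ⟨m, hm, hmp⟩ := exists_line_through α hp0 h2
        have h3 := (hF.survE_le_real_Ioi hm hmp hv.le hp).trans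
          (measureReal_mono Ioi_subset_Ici_self)
        rw [hlv, survE_le_iff hα (by positivity) (by positivity)] at h3
        rw [hmp]
        exact survE_antitone hα (by positivity)
          (mul_le_mul_of_nonneg_right (le_of_mul_le_mul_right h3 hv) hp0.le)

/-- For `α > 0`, a regular distribution of positive optimal revenue has an optimal price. -/
lemma IsRegular.exists_optimal_price (hF : IsRegular α F) (hα0 : (0 : ℝ) < α)
    (h : 0 < opt F) : ∃ a, 0 < a ∧ 0 < rev a F ∧ ∀ p, rev p F ≤ rev a F := by
  obtain ⟨q, hq⟩ := lt_iSup_iff.1 h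
  have hq' : 0 < rev q F := EReal.coe_lt_coe_iff.1 hq
  obtain ⟨X, hX⟩ := eventually_atTop.1 ((hF.tendsto_rev hα0).eventually (gt_mem_nhds hq'))
  have hbdd : BddAbove ((fun p => rev p F) '' Icc 0 X) := ⟨X, by
    rintro _ ⟨p, hp, rfl⟩
    exact (rev_le_self hp.1).trans hp.2⟩
  have hq0 : 0 < q := by
    by_contra hneg
    rw [rev_of_nonpos (not_lt.1 hneg)] at hq'
    exact hneg hq'
  have hqX : q ∈ Icc 0 X :=
    ⟨hq0.le, (not_lt.1 fun hlt => lt_irrefl _ (hX q hlt.le))⟩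
  obtain ⟨r, -, hr, hrm⟩ := exists_seq_tendsto_sSup ⟨_, mem_image_of_mem _ hqX⟩ hbdd
  choose u hu hur using hrm
  obtain ⟨a, ha, φ, hφ, hlim⟩ := isCompact_Icc.tendsto_subseq hu
  set M := sSup ((fun p => rev p F) '' Icc 0 X) with hM
  have hMq : rev q F ≤ M := le_csSup hbdd (mem_image_of_mem _ hqX)
  have hle : ∀ v < a, M ≤ a * F.law.real (Ici v) := fun v hv => by
    refine le_of_tendsto_of_tendsto (hr.comp hφ.tendsto_atTop)
      (hlim.mul_const (F.law.real (Ici v))) ?_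
    filter_upwards [hlim.eventually (lt_mem_nhds hv)] with n hn
    simp only [Function.comp] at hn ⊢
    rw [← hur]
    exact mul_le_mul_of_nonneg_left (real_Ici_anti F hn.le) (hu _).1
  have ha0 : 0 < a := by
    refine lt_of_le_of_ne ha.1 fun h0 => ?_
    have := hle (a - 1) (by linarith)
    rw [← h0, zero_mul] at this
    linarith
  have haM : M ≤ rev a F := by
    by_contra hlt
    have h1 : F.law.real (Ici a) < M / a := by
      rw [lt_div_iff₀ ha0, mul_comm]; exact not_le.1 hlt
    obtain ⟨v, -, hva, hv⟩ := exists_real_Ici_lt F h1 (sub_one_lt a)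
    rw [lt_div_iff₀ ha0, mul_comm] at hv
    exact absurd (hle v hva) (not_le.2 hv)
  refine ⟨a, ha0, by linarith, fun p => ?_⟩
  rcases le_total p 0 with hp | hp
  · rw [rev_of_nonpos hp]; exact hp.trans (rev_nonneg ha0.le)
  · rcases le_total p X with hpX | hpX
    · exact (le_csSup hbdd (mem_image_of_mem _ ⟨hp, hpX⟩)).trans haM
    · linarith [hX p hpX]

/-- A regular distribution with optimal price `a` dominates the minimal distribution whose atom is
at `a` and which has the same optimal revenue; the revenue curve of the latter is lower below
`a`. -/
lemma IsRegular.exists_minimalDist (hF : IsRegular α F) (hα0 : (0 : ℝ) < α) {a : ℝ≥0}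
    (ha : 0 < a) (hr : 0 < rev a F) (hopt : ∀ p, rev p F ≤ rev a F) :
    ∃ l : ℝ≥0, (α : ℝ) * l * a ≤ 1 ∧ Dominates F (minimalDist α l a) ∧
      rev a (minimalDist α l a) = rev a F ∧
      ∀ v : ℝ, 0 ≤ v → v ≤ a → rev v (minimalDist α l a) ≤ rev v F := by
  have hα : (α : ℝ) ≤ 1 := α.2.2
  have ha' : (0 : ℝ) < a := ha
  have hpos : 0 < F.law.real (Ici (a : ℝ)) := pos_of_mul_pos_right hr ha'.le
  obtain ⟨l, hl, hla⟩ := exists_line_through α ha' hpos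
  lift l to ℝ≥0 using hl
  have hchord : ∀ v : ℝ, 0 ≤ v → v < a → survE α (l * v) ≤ F.law.real (Ioi v) := fun v hv hva =>
    hF.survE_le_real_Ioi l.2 hla hv hva
  have hra : rev a (minimalDist α l a) = rev a F := by
    rw [rev_minimalDist a.coe_nonneg le_rfl, rev, hla]
  have hrle : ∀ v : ℝ, 0 ≤ v → v ≤ a → rev v (minimalDist α l a) ≤ rev v F := fun v hv hva => by
    rcases hva.eq_or_lt with rfl | hlt
    · exact hra.le
    · rw [rev_minimalDist hv hva]
      exact mul_le_mul_of_nonneg_left ((hchord v hv hlt).trans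
        (measureReal_mono Ioi_subset_Ici_self)) hv
  refine ⟨l, ?_, fun v => ?_, hra, hrle⟩
  · -- Otherwise the price `1 / (α l) < a` would earn strictly more than `a`.
    by_contra hgt
    have hgt' : 1 < (α : ℝ) * (l * a) := by rw [← mul_assoc]; exact not_le.1 hgt
    have hl0 : (0 : ℝ) < l := by
      rcases l.2.eq_or_lt with h0 | h0
      · simp only [NNReal.val_eq_coe] at h0
        rw [← h0] at hgt'
        norm_num at hgt'
      · exact h0
    have hlt : 1 / (α : ℝ) < l * a := by rwa [div_lt_iff₀' hα0]
    have h1 : 0 < 1 / (α : ℝ) := by positivity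
    have h2 := mul_survE_strictAnti (α := α) (β := 0) hα0 hα
      (by rw [sub_zero]; exact one_add_mul_pos hα h1.le) hlt
      (by rw [mul_one_div_cancel hα0.ne']; linarith)
    simp only [sub_zero] at h2
    have h3 : 1 / (α : ℝ) / l ≤ a := by rw [div_le_iff₀ hl0]; linarith
    have h4 := (hrle _ (by positivity) h3).trans (hopt _)
    rw [← hra, rev_minimalDist (by positivity) h3, rev_minimalDist a.coe_nonneg le_rfl,
      mul_div_cancel₀ _ hl0.ne', div_mul_eq_mul_div, div_le_iff₀ hl0] at h4
    linarith
  · rw [minimalDist_cdf]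
    split_ifs with h1 h2
    · have := real_Ioi_of_neg F h1
      rw [real_Ioi] at this
      linarith
    · have := hchord v (not_lt.1 h1) h2
      rw [real_Ioi] at this
      linarith
    · exact cdf_le_one F v

lemma dominates_maximalDist_of_line {w m : ℝ} {l b : ℝ≥0} (hlb : 1 ≤ l * b) (hm : m = l)
    (hb : 0 ≤ w + m * (b - x))
    (hline : ∀ v, F.law.real (Ioi v) ≤ survE α (max (w + m * (v - x)) 0)) :
    Dominates (maximalDist α l b hlb) F := fun v => by
  subst hm
  rw [maximalDist_cdf]
  split_ifs with h1
  · exact measureReal_nonneg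
  · have h2 := hline v
    rw [real_Ioi] at h2
    have h3 : 0 ≤ (l : ℝ) * (v - b) := mul_nonneg l.2 (sub_nonneg.2 (not_lt.1 h1))
    have h4 : survE α (max (w + l * (v - x)) 0) ≤ survE α (l * (v - b)) := by
      refine survE_antitone α.2.2 h3 (le_trans ?_ (le_max_left _ _))
      linarith
    linarith

/-- If a price `x` above the optimal price `a` of a regular distribution earns less than the
fraction `Γ` of the optimal revenue, then the distribution is dominated by maximal distributions
for which the largest `Γ`-approximate price is at most `x`, up to `ε`. The maximal distribution is
read off the supporting line at `x`: it starts at the zero of this line, or, where the line is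
too flat, at the price at which a maximal distribution of the same slope has its optimum. The bound
`ε` is needed only when `x` lies above the support. -/
lemma IsRegular.exists_maximalDist (hF : IsRegular α F) (hα0 : (0 : ℝ) < α) (hΓ : 0 < Γ)
    (hΓ1 : Γ ≤ 1) (ha : 0 < a) (hax : a < x) (h : rev x F < Γ * rev a F) {ε : ℝ} (hε : 0 < ε) :
    ∃ (l b : ℝ≥0) (hlb : 1 ≤ l * b), Dominates (maximalDist α l b hlb) F ∧
      upperPrice (maximalDist α l b hlb) Γ ≤ ((x + ε : ℝ) : EReal) := by
  have hα : (α : ℝ) ≤ 1 := α.2.2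
  have hx0 : 0 < x := ha.trans hax
  rcases (measureReal_nonneg (μ := F.law) (s := Ioi x)).eq_or_lt with hS | hS
  · -- The support ends at `x`: steep maximal distributions starting at `x`.
    have h1 : Tendsto (fun l : ℝ => (x + ε) * survE α (l * ε)) atTop (𝓝 ((x + ε) * 0)) :=
      ((survE_tendsto hα).comp (tendsto_id.atTop_mul_const hε)).const_mul _
    rw [mul_zero] at h1
    obtain ⟨l, hl1, hl2⟩ := ((h1.eventually (gt_mem_nhds (mul_pos hΓ hx0))).and
      (eventually_ge_atTop (1 / x))).exists
    have hl0 : 0 ≤ l := (by positivity : 0 ≤ 1 / x).trans hl2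
    rw [div_le_iff₀ hx0] at hl2
    lift l to ℝ≥0 using hl0
    lift x to ℝ≥0 using hx0.le
    have hlb : 1 ≤ l * x := by exact_mod_cast hl2
    refine ⟨l, x, hlb, fun v => ?_, upperPrice_maximalDist_le hlb hΓ.le (by linarith) ?_⟩
    · rw [maximalDist_cdf]
      split_ifs with hv
      · exact measureReal_nonneg
      · have h2 := cdf_mono F (not_lt.1 hv)
        rw [real_Ioi] at hS
        have h3 := survE_nonneg hα (mul_nonneg l.2 (sub_nonneg.2 (not_lt.1 hv)))
        simp only [NNReal.val_eq_coe] at h3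
        linarith
    · rwa [add_sub_cancel_left]
  suffices hmain : ∃ (l b : ℝ≥0) (hlb : 1 ≤ l * b), Dominates (maximalDist α l b hlb) F ∧
      upperPrice (maximalDist α l b hlb) Γ ≤ x by
    obtain ⟨l, b, hlb, hdom, hup⟩ := hmain
    exact ⟨l, b, hlb, hdom, hup.trans (EReal.coe_le_coe_iff.2 (by linarith))⟩
  obtain ⟨w, l, hw, hl, hwx, hwl, hline⟩ :=
    hF.exists_supporting_line (x := x) (by rw [real_Ioi] at hS; linarith)
  have hra : rev a F ≤ a := rev_le_self ha.le
  have hxw : x * survE α w < Γ * rev a F := by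
    refine lt_of_le_of_lt ?_ h
    rw [hwx]
    exact mul_le_mul_of_nonneg_left (measureReal_mono Ioi_subset_Ici_self) hx0.le
  have hl0 : 0 < l := by
    rcases hl.eq_or_lt with rfl | h1
    · have : w = 0 := le_antisymm (by simpa using hwl) hw
      rw [this, survE_zero, mul_one] at hxw
      nlinarith
    · exact h1
  by_cases hcase : w ≤ l * x - 1
  · have hb0 : 0 ≤ x - w / l := by
      rw [sub_nonneg, div_le_iff₀ hl0]; linarith
    lift l to ℝ≥0 using hl
    obtain ⟨b, hb⟩ : ∃ b : ℝ≥0, (b : ℝ) = x - w / l := ⟨⟨_, hb0⟩, rfl⟩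
    have hlw : (l : ℝ) * (x - b) = w := by rw [hb]; field_simp; ring
    have hlb : 1 ≤ l * b := by
      have : (1 : ℝ) ≤ l * b := by linarith
      exact_mod_cast this
    have hdom := dominates_maximalDist_of_line (x := x) hlb rfl (by linarith) hline
    have hbx : (b : ℝ) ≤ x := by rw [hb]; linarith [div_nonneg hw hl0.le]
    refine ⟨l, b, hlb, hdom, upperPrice_maximalDist_le hlb hΓ.le hbx ?_⟩
    rw [hlw]
    refine hxw.trans_le (mul_le_mul_of_nonneg_left
      (le_trans ?_ (rev_maximalDist_le (α := α) hlb a)) hΓ.le)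
    exact mul_le_mul_of_nonneg_left (hdom.real_Ici_le a) ha.le
  · have hcase' : l * x - 1 < w := not_le.1 hcase
    have hDa : 0 < 1 + (1 - (α : ℝ)) * (l * a - 1) := by
      have : 0 ≤ (1 - (α : ℝ)) * (l * a) := mul_nonneg (by linarith) (by positivity)
      linarith
    have hlax : l * a < l * x := mul_lt_mul_of_pos_left hax hl0
    -- The survival function at `a` is bounded by the value at `a` of the supporting line.
    have hPa : F.law.real (Ici a) ≤ survE α (w - l * (x - a)) := by
      have h1 : F.law.real (Ici a) ≤ survE α (max (w + l * (a - x)) 0) := by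
        refine le_of_tendsto_of_tendsto' (tendsto_real_Ioi F a) ?_ hline
        exact tendsto_nhdsWithin_of_tendsto_nhds (Continuous.tendsto
          (survE_continuous hα (g := fun y => max (w + l * (y - x)) 0) (by fun_prop)
            fun _ => le_max_right _ _) a)
      refine h1.trans (survE_le hα ?_ (le_trans (by linarith) (le_max_left _ _)))
      have : (1 - (α : ℝ)) * (l * a - 1) ≤ (1 - α) * (w - l * (x - a)) :=
        mul_le_mul_of_nonneg_left (by linarith) (by linarith)
      linarith
    have hEd : 0 < survE α (w - l * (x - a)) := by
      have : 0 < F.law.real (Ici a) :=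
        hS.trans_le (measureReal_mono (Ioi_subset_Ici_self.trans (Ici_subset_Ici.2 hax.le)))
      linarith
    -- By log-convexity of `E` the revenue ratio between `x` and `a` can only grow when the line is
    -- moved until the optimum of the maximal distribution is its lower end.
    have hratio : l * x * survE α (l * x - 1) < Γ * (l * a * survE α (l * a - 1)) := by
      have h1 := survE_mul_le (d := l * (x - a)) hα
        (mul_nonneg hl (by linarith)) hcase'.le (by convert hDa using 3; ring)
      have h2 : l * x - 1 - l * (x - a) = l * a - 1 := by ring
      rw [h2] at h1
      have h3 : x * survE α w < Γ * (a * survE α (w - l * (x - a))) :=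
        hxw.trans_le (mul_le_mul_of_nonneg_left (mul_le_mul_of_nonneg_left hPa ha.le) hΓ.le)
      have h4 : 0 < survE α (l * a - 1) := survE_pos hDa
      refine lt_of_mul_lt_mul_right ?_ hEd.le
      calc l * x * survE α (l * x - 1) * survE α (w - l * (x - a))
          = l * x * (survE α (l * x - 1) * survE α (w - l * (x - a))) := by ring
        _ ≤ l * x * (survE α w * survE α (l * a - 1)) :=
            mul_le_mul_of_nonneg_left h1 (by positivity)
        _ = l * survE α (l * a - 1) * (x * survE α w) := by ring
        _ < l * survE α (l * a - 1) * (Γ * (a * survE α (w - l * (x - a)))) :=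
            mul_lt_mul_of_pos_left h3 (by positivity)
        _ = _ := by ring
    have hρ : l * a * survE α (l * a - 1) ≤ 1 := by
      rcases le_total (l * a) 1 with h1 | h1
      · have := mul_survE_mono (z := 1) (β := 1) α.2.1 hα hDa h1 (by linarith)
        simpa [survE_zero] using this
      · have := mul_survE_anti (y := 1) (β := 1) α.2.1 hα (by simp) h1 (by linarith)
        simpa [survE_zero] using this
    have hρ0 : 0 ≤ l * a * survE α (l * a - 1) :=
      mul_nonneg (by positivity) (survE_pos hDa).le
    have hlx : 1 ≤ l * x := by
      by_contra hlt
      have := mul_survE_mono (z := l * x) (β := 1) α.2.1 hα hDa hlax.le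
        (by nlinarith [not_le.1 hlt])
      nlinarith
    lift l to ℝ≥0 using hl
    have hl0' : l ≠ 0 := fun h0 => by simp [h0] at hl0
    have hlb : 1 ≤ l * l⁻¹ := by rw [mul_inv_cancel₀ hl0']
    have hlb' : (l : ℝ) * (l⁻¹ : ℝ≥0) = 1 := by
      rw [NNReal.coe_inv]; exact mul_inv_cancel₀ hl0.ne'
    refine ⟨l, l⁻¹, hlb, dominates_maximalDist_of_line (x := x) hlb rfl (by linarith) hline,
      upperPrice_maximalDist_le hlb hΓ.le ?_ ?_⟩
    · refine le_of_mul_le_mul_left ?_ hl0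
      linarith
    · refine lt_of_mul_lt_mul_left ?_ hl0.le
      have h1 : (l : ℝ) * (x - (l⁻¹ : ℝ≥0)) = l * x - 1 := by linarith
      rw [h1]
      nlinarith

end comparison

/-! ### Compactness of the feasible pricing functions -/

section compactness

lemma exists_subseq_tendsto_countable {ι : Type*} [Countable ι] {g : ℕ → ι → ℝ} {B : ι → ℝ}
    (hB : ∀ n i, |g n i| ≤ B i) : ∃ φ : ℕ → ℕ, StrictMono φ ∧ ∃ G : ι → ℝ,
      ∀ i, Tendsto (fun n => g (φ n) i) atTop (𝓝 (G i)) := by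
  have hc : IsCompact (univ.pi fun i => Icc (-B i) (B i)) :=
    isCompact_univ_pi fun i => isCompact_Icc
  obtain ⟨G, -, φ, hφ, hG⟩ := hc.tendsto_subseq (x := g) fun n i _ => abs_le.1 (hB n i)
  exact ⟨φ, hφ, G, fun i => (tendsto_pi_nhds.1 hG i)⟩

/-- Helly's selection theorem: a pointwise bounded sequence of non-decreasing functions has a
pointwise convergent subsequence. -/
theorem exists_subseq_tendsto_of_monotone {g : ℕ → ℝ → ℝ} (hg : ∀ n, Monotone (g n)) {B : ℝ → ℝ}
    (hB : ∀ n x, |g n x| ≤ B x) : ∃ φ : ℕ → ℕ, StrictMono φ ∧ ∃ G : ℝ → ℝ, Monotone G ∧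
      ∀ x, Tendsto (fun n => g (φ n) x) atTop (𝓝 (G x)) := by
  obtain ⟨φ, hφ, L, hL⟩ := exists_subseq_tendsto_countable (ι := ℚ) (g := fun n q => g n q)
    (B := fun q => B q) fun n q => hB n q
  have hlo : ∀ x, IsBoundedUnder (· ≥ ·) atTop fun n => g (φ n) x := fun x =>
    isBoundedUnder_of ⟨-B x, fun n => (abs_le.1 (hB _ x)).1⟩
  have hup : ∀ x, IsBoundedUnder (· ≤ ·) atTop fun n => g (φ n) x := fun x =>
    isBoundedUnder_of ⟨B x, fun n => (abs_le.1 (hB _ x)).2⟩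
  set G₁ : ℝ → ℝ := fun x => liminf (fun n => g (φ n) x) atTop with hG₁
  have hmono : Monotone G₁ := fun x y hxy =>
    liminf_le_liminf (Eventually.of_forall fun n => hg _ hxy) (hlo x) (hup y).isCoboundedUnder_ge
  -- At continuity points of `G₁` the convergence on the rationals forces convergence.
  have hcont : ∀ x, ContinuousAt G₁ x → Tendsto (fun n => g (φ n) x) atTop (𝓝 (G₁ x)) :=
    fun x hx => by
    refine tendsto_of_le_liminf_of_limsup_le le_rfl ?_ (hup x) (hlo x)
    refine le_of_forall_gt_imp_ge_of_dense fun c hc => ?_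
    obtain ⟨y, hxy, hy⟩ := (((hx.tendsto.eventually (gt_mem_nhds hc)).filter_mono
      nhdsWithin_le_nhds).and (self_mem_nhdsWithin (a := x) (s := Ioi x))).exists
    obtain ⟨q, hq1, hq2⟩ := exists_rat_btwn hy
    have h1 : G₁ q = L q := (hL q).liminf_eq
    calc limsup (fun n => g (φ n) x) atTop ≤ limsup (fun n => g (φ n) q) atTop :=
          limsup_le_limsup (Eventually.of_forall fun n => hg _ hq1.le)
            (hlo x).isCoboundedUnder_le (hup q)
      _ = G₁ q := by rw [(hL q).limsup_eq, h1]
      _ ≤ c := (hmono hq2.le).trans hxy.le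
  have : Countable {x | ¬ ContinuousAt G₁ x} := hmono.countable_not_continuousAt.to_subtype
  obtain ⟨ψ, hψ, L', hL'⟩ := exists_subseq_tendsto_countable (ι := {x | ¬ ContinuousAt G₁ x})
    (g := fun n x => g (φ n) x) (B := fun x => B x) fun n x => hB _ x
  have hall : ∀ x, ∃ y, Tendsto (fun n => g (φ (ψ n)) x) atTop (𝓝 y) := fun x => by
    by_cases hx : ContinuousAt G₁ x
    · exact ⟨_, (hcont x hx).comp hψ.tendsto_atTop⟩
    · exact ⟨_, hL' ⟨x, hx⟩⟩
  choose G hG using hall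
  exact ⟨φ ∘ ψ, hφ.comp hψ, G,
    fun x y hxy => le_of_tendsto_of_tendsto' (hG x) (hG y) fun n => hg _ hxy, hG⟩

variable {α : Icc (0 : ℝ) 1} {Γ : ℝ} {g : ℝ → ℝ}

/-- Point masses force a feasible pricing function above the line of slope `Γ`. -/
lemma mul_le_of_mem_feasible (hΓ : 0 ≤ Γ) (hg : g ∈ feasible α Γ) {s : ℝ} (hs : 0 ≤ s) :
    Γ * s ≤ g s := by
  lift s to ℝ≥0 using hs
  have h1 := hg.2 0 s (by simp)
  rw [extExp_pointMass] at h1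
  have h2 : rev s (minimalDist α 0 s) = s := by
    rw [rev_minimalDist s.coe_nonneg le_rfl]
    simp [survE_zero]
  have h3 := le_lowerPrice (F := minimalDist α 0 s) (x := Γ * s) (R := s) hΓ
    ((EReal.coe_le_coe_iff.2 h2.ge).trans (rev_le_opt _ _)) fun p hp => by
      rcases le_total p 0 with h0 | h0
      · rwa [rev_of_nonpos h0]
      · exact (rev_le_self h0).trans_lt hp
  exact EReal.coe_le_coe_iff.1 (h3.trans h1)

lemma nonneg_of_mem_feasible (hΓ : 0 ≤ Γ) (hg : g ∈ feasible α Γ) (s : ℝ) (hs : 0 ≤ s) :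
    0 ≤ g s := (mul_nonneg hΓ hs).trans (mul_le_of_mem_feasible hΓ hg hs)

/-- Limits of pointwise bounded feasible functions: feasibility passes to the limit by dominated
convergence, because the minimal distributions have bounded support, and the expectation does not
increase, by Fatou's lemma. -/
lemma exists_feasible_limit (F : ValueDist) {Γs : ℕ → ℝ} (hΓs : ∀ n, 0 ≤ Γs n) (hΓ : 0 ≤ Γ)
    (hΓ1 : Γ ≤ 1) (hlim : Tendsto Γs atTop (𝓝 Γ)) {g : ℕ → ℝ → ℝ}
    (hg : ∀ n, g n ∈ feasible α (Γs n)) {B : ℝ → ℝ} (hB : ∀ n s, 0 ≤ s → g n s ≤ B s)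
    {c : ℕ → EReal} {c' : EReal} (hc : ∀ n, extExp F.law (g n) ≤ c n)
    (hc' : Tendsto c atTop (𝓝 c')) : ∃ G ∈ feasible α Γ, extExp F.law G ≤ c' := by
  have hg0 : ∀ n s, 0 ≤ s → 0 ≤ g n s := fun n => nonneg_of_mem_feasible (hΓs n) (hg n)
  obtain ⟨φ, hφ, G, hGm, hG⟩ := exists_subseq_tendsto_of_monotone
    (g := fun n s => g n (max s 0)) (B := fun s => B (max s 0))
    (fun n x y hxy => (hg n).1 (max_le_max_right 0 hxy)) (fun n x => by
      rw [abs_of_nonneg (hg0 n _ (le_max_right _ _))]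
      exact hB n _ (le_max_right _ _))
  have hG0 : ∀ s, 0 ≤ s → 0 ≤ G s := fun s hs =>
    ge_of_tendsto' (hG s) fun n => hg0 _ _ (le_max_right _ _)
  have hGs : ∀ s, 0 ≤ s → Tendsto (fun n => g (φ n) s) atTop (𝓝 (G s)) := fun s hs => by
    have := hG s
    simpa only [max_eq_left hs] using this
  have hmeas : ∀ n, Measurable fun s => ENNReal.ofReal (g n s) := fun n =>
    (hg n).1.measurable.ennreal_ofReal
  refine ⟨G, ⟨hGm, fun l a hla => ?_⟩, ?_⟩
  · have h1 : Tendsto (fun n => extExp (minimalDist α l a).law (g (φ n))) atTop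
        (𝓝 (extExp (minimalDist α l a).law G)) := by
      simp only [extExp_eq_lintegral _ (hg0 _), extExp_eq_lintegral _ hG0]
      refine (continuous_coe_ennreal_ereal.tendsto _).comp
        (tendsto_lintegral_of_dominated_convergence (fun _ => ENNReal.ofReal (B a))
          (fun n => hmeas _) (fun n => ?_) (by simp) ?_)
      · filter_upwards [minimalDist_ae_le] with s hs
        exact ENNReal.ofReal_le_ofReal (((hg _).1 hs).trans (hB _ _ a.2))
      · filter_upwards [ae_nonneg (minimalDist α l a)] with s hs
        exact ENNReal.tendsto_ofReal (hGs s hs)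
    rw [← EReal.ge_of_forall_gt_iff_ge]
    intro q hq
    set M := minimalDist α l a
    have hqa : q ≤ a :=
      (EReal.coe_lt_coe_iff.1 (hq.trans_le (lowerPrice_minimalDist_le hΓ hΓ1 hla))).le
    have hq1 : rev q M < Γ * rev a M := by
      by_contra hcon
      refine absurd (lowerPrice_le ?_) (not_le.2 hq)
      exact (mul_opt_le hΓ (opt_minimalDist hla).le).trans (EReal.coe_le_coe_iff.2 (not_lt.1 hcon))
    refine ge_of_tendsto h1 ?_
    filter_upwards [((hlim.comp hφ.tendsto_atTop).mul_const (rev a M)).eventually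
      (lt_mem_nhds hq1)] with n hn
    refine le_trans ?_ ((hg (φ n)).2 l a hla)
    exact le_lowerPrice (hΓs _) (opt_minimalDist hla).ge fun p hp =>
      (rev_minimalDist_mono hla hp.le hqa).trans_lt hn
  · by_contra hcon
    obtain ⟨r, hr1, hr2⟩ := exists_between (not_le.1 hcon)
    have hev : ∀ᶠ n in atTop, ∫⁻ s, ENNReal.ofReal (g (φ n) s) ∂F.law ≤ r.toENNReal := by
      filter_upwards [(hc'.comp hφ.tendsto_atTop).eventually (gt_mem_nhds hr1)] with n hn
      have h1 := (hc (φ n)).trans hn.le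
      rw [extExp_eq_lintegral _ (hg0 _)] at h1
      rw [← EReal.coe_ennreal_le_coe_ennreal_iff, EReal.coe_toENNReal
        ((EReal.coe_ennreal_nonneg _).trans h1)]
      exact h1
    have hr0 : 0 ≤ r := by
      obtain ⟨n, hn⟩ := ((hc'.comp hφ.tendsto_atTop).eventually (gt_mem_nhds hr1)).exists
      exact (extExp_nonneg F (hg0 _)).trans ((hc (φ n)).trans hn.le)
    have h2 : ∫⁻ s, ENNReal.ofReal (G s) ∂F.law ≤ r.toENNReal := by
      calc ∫⁻ s, ENNReal.ofReal (G s) ∂F.law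
          = ∫⁻ s, liminf (fun n => ENNReal.ofReal (g (φ n) s)) atTop ∂F.law := by
            refine lintegral_congr_ae ?_
            filter_upwards [ae_nonneg F] with s hs
            exact (ENNReal.tendsto_ofReal (hGs s hs)).liminf_eq.symm
        _ ≤ liminf (fun n => ∫⁻ s, ENNReal.ofReal (g (φ n) s) ∂F.law) atTop :=
            lintegral_liminf_le fun n => hmeas _
        _ ≤ r.toENNReal := (liminf_le_liminf hev).trans (by simp)
    rw [extExp_eq_lintegral F hG0] at hr2
    rw [← EReal.coe_ennreal_le_coe_ennreal_iff, EReal.coe_toENNReal hr0] at h2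
    exact absurd h2 (not_le.2 hr2)

end compactness

/-! ### Existence of minimizers -/

section minimizers

variable {α : Icc (0 : ℝ) 1} {Γ : ℝ} {g : ℝ → ℝ}

lemma survE_inv_pos (α : Icc (0 : ℝ) 1) : 0 < survE α (1 / α) :=
  survE_pos (one_add_mul_pos α.2.2 (one_div_nonneg.2 α.2.1))

/-- For `α > 0` the atoms of the minimal distributions are bounded away from zero. -/
lemma survE_inv_le_real_Ici (hα0 : (0 : ℝ) < α) {l a : ℝ≥0} (h : (α : ℝ) * l * a ≤ 1) :
    survE α (1 / α) ≤ (minimalDist α l a).law.real (Ici (a : ℝ)) := by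
  rw [minimalDist_real_Ici a.coe_nonneg le_rfl]
  refine survE_antitone α.2.2 (by positivity) ?_
  rw [le_div_iff₀ hα0]
  linarith

/-- Beyond a point `M`, a feasible pricing function may be replaced by the line of slope
`1 / E(1/α)`, and below `M` it may be capped at `M / E(1/α)`: the atom of a minimal distribution
alone pays for its lowest approximate price wherever the function has changed. -/
lemma truncate_mem_feasible (hα0 : (0 : ℝ) < α) (hΓ : 0 ≤ Γ) (hΓ1 : Γ ≤ 1)
    (hg : g ∈ feasible α Γ) {M : ℝ} (hM : 0 ≤ M) :
    (fun s => if s ≤ M then min (g s) (M / survE α (1 / α)) else s / survE α (1 / α))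
      ∈ feasible α Γ := by
  have hc := survE_inv_pos α
  set c := survE α (1 / α)
  have hg0 := nonneg_of_mem_feasible hΓ hg
  set g' : ℝ → ℝ := fun s => if s ≤ M then min (g s) (M / c) else s / c with hg'
  have hm : Monotone g' := fun s t hst => by
    simp only [hg']
    split_ifs with h1 h2 h2
    · exact min_le_min_right _ (hg.1 hst)
    · exact (min_le_right _ _).trans (by gcongr; linarith)
    · linarith
    · gcongr
  have hg0' : ∀ s, 0 ≤ s → 0 ≤ g' s := fun s hs => by
    simp only [hg']
    split_ifs
    · exact le_min (hg0 s hs) (by positivity)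
    · positivity
  refine ⟨hm, fun l a hla => ?_⟩
  by_cases hcase : a / c ≤ g' a
  · refine (lowerPrice_minimalDist_le hΓ hΓ1 hla).trans (le_trans (EReal.coe_le_coe_iff.2 ?_)
      (mul_real_Ici_le_extExp _ hm hg0' a.2))
    calc (a : ℝ) = a / c * c := by field_simp
      _ ≤ _ := mul_le_mul hcase (survE_inv_le_real_Ici hα0 hla) hc.le (hg0' _ a.2)
  · have haM : (a : ℝ) ≤ M := by
      by_contra h1
      exact hcase (by simp only [hg', if_neg h1]; exact le_rfl)
    have hga : g a ≤ M / c := by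
      by_contra h1
      refine hcase ?_
      simp only [hg', if_pos haM, min_eq_right (not_le.1 h1).le]
      gcongr
    rw [extExp_eq_lintegral _ hg0', lintegral_congr_ae (g := fun s => ENNReal.ofReal (g s)),
      ← extExp_eq_lintegral _ hg0]
    · exact hg.2 l a hla
    · filter_upwards [minimalDist_ae_le] with s hs
      simp only [hg', if_pos (hs.trans haM), min_eq_left ((hg.1 hs).trans hga)]

lemma exists_isBuyerOptimal (hα0 : (0 : ℝ) < α) (hΓ : 0 ≤ Γ) (hΓ1 : Γ ≤ 1)
    (hne : (feasible α Γ).Nonempty) (F : ValueDist) : ∃ g, IsBuyerOptimal α Γ F g := by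
  obtain ⟨c, -, hc, hmem⟩ := exists_seq_tendsto_sInf
    (hne.image fun g => extExp F.law g) (OrderBot.bddBelow _)
  choose g hg hgc using hmem
  simp only at hgc
  have hmin : ∀ g' ∈ feasible α Γ, sInf ((fun g => extExp F.law g) '' feasible α Γ)
      ≤ extExp F.law g' := fun g' hg' => sInf_le (mem_image_of_mem _ hg')
  set I := sInf ((fun g => extExp F.law g) '' feasible α Γ)
  suffices h : ∃ G ∈ feasible α Γ, extExp F.law G ≤ I by
    obtain ⟨G, hG, hGI⟩ := h
    exact ⟨G, hG, fun g' hg' => hGI.trans (hmin g' hg')⟩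
  by_cases hI : I = ⊤
  · obtain ⟨G, hG⟩ := hne
    exact ⟨G, hG, hI ▸ le_top⟩
  have hg0 : ∀ n s, 0 ≤ s → 0 ≤ g n s := fun n => nonneg_of_mem_feasible hΓ (hg n)
  by_cases hsupp : ∃ M, 0 ≤ M ∧ F.law (Ioi M) = 0
  · obtain ⟨M, hM, hFM⟩ := hsupp
    have hcpos := survE_inv_pos α
    have ht := fun n => truncate_mem_feasible hα0 hΓ hΓ1 (hg n) hM
    refine exists_feasible_limit F (Γs := fun _ => Γ) (fun _ => hΓ) hΓ hΓ1 tendsto_const_nhds ht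
      (B := fun s => max M s / survE α (1 / α)) (fun n s hs => ?_) (fun n => ?_) hc
    · split_ifs
      · exact (min_le_right _ _).trans (by gcongr; exact le_max_left _ _)
      · gcongr; exact le_max_right _ _
    · rw [← hgc, extExp_eq_lintegral _ (nonneg_of_mem_feasible hΓ (ht n)),
        extExp_eq_lintegral _ (hg0 n), EReal.coe_ennreal_le_coe_ennreal_iff]
      refine lintegral_mono_ae ?_
      have : ∀ᵐ s ∂F.law, s ≤ M := by
        rw [ae_iff]; convert hFM using 2; ext s; simp
      filter_upwards [this] with s hs
      simp only [if_pos hs]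
      exact ENNReal.ofReal_le_ofReal (min_le_left _ _)
  · push Not at hsupp
    obtain ⟨C, hC1, -⟩ := EReal.lt_iff_exists_real_btwn.1 (Ne.lt_top hI)
    obtain ⟨N, hN⟩ := eventually_atTop.1 (hc.eventually (gt_mem_nhds hC1))
    refine exists_feasible_limit F (Γs := fun _ => Γ) (fun _ => hΓ) hΓ hΓ1 tendsto_const_nhds
      (fun n => hg (n + N)) (B := fun s => C / F.law.real (Ici s)) (fun n s hs => ?_)
      (fun n => (hgc (n + N)).le) (hc.comp (tendsto_add_atTop_nat N))
    have hpos : 0 < F.law.real (Ici s) :=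
      (ENNReal.toReal_pos (hsupp s hs) (measure_ne_top _ _)).trans_le
        (measureReal_mono Ioi_subset_Ici_self)
    rw [le_div_iff₀ hpos]
    refine EReal.coe_le_coe_iff.1 ((mul_real_Ici_le_extExp F (hg (n + N)).1 (hg0 _) hs).trans ?_)
    rw [hgc]
    exact (hN _ (by omega)).le

end minimizers

/-! ### The tight ratio is attained -/

section attained

variable {α : Icc (0 : ℝ) 1} {Γ : ℝ}

lemma extExp_zero (F : ValueDist) : extExp F.law (fun _ => 0) = 0 := by simp [extExp]

lemma zero_mem_feasible : (fun _ => 0) ∈ feasible α 0 :=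
  ⟨monotone_const, fun l a _ => by
    rw [extExp_zero]
    exact lowerPrice_le (p := 0) (by simp [rev])⟩

lemma isBuyerOptimal_zero (F : ValueDist) : IsBuyerOptimal α 0 F fun _ => 0 :=
  ⟨zero_mem_feasible, fun g' hg' => by
    rw [extExp_zero]
    exact extExp_nonneg F (nonneg_of_mem_feasible le_rfl hg')⟩

lemma zero_mem_admissibleRatios (α : Icc (0 : ℝ) 1) : (0 : ℝ) ∈ admissibleRatios α :=
  ⟨⟨le_rfl, zero_le_one⟩, fun l b hlb => ⟨fun _ => 0, isBuyerOptimal_zero _, by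
    rw [extExp_zero]
    exact le_upperPrice (p := 0) (by simp [rev])⟩⟩

/-- For `α = 0` no positive ratio is possible: a maximal distribution has infinite mean, so that
the expectation of every feasible pricing function is infinite, while its revenue curve tends to
`1 / l`, so that its `Γ`-approximate prices are bounded once `l` is large. -/
lemma not_exists_feasible_of_eq_zero (hα : (α : ℝ) = 0) (hΓ : 0 < Γ)
    (h : ∀ (l b : ℝ≥0) (hlb : 1 ≤ l * b), ∃ g ∈ feasible α Γ,
      extExp (maximalDist α l b hlb).law g ≤ upperPrice (maximalDist α l b hlb) Γ)
    (hΓ1 : Γ ≤ 1) : False := by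
  have hE : ∀ v, survE α v = (1 + v)⁻¹ := fun v => by
    rw [hα, survE_of_ne zero_ne_one]
    norm_num [Real.rpow_neg_one]
  obtain ⟨l, hl⟩ : ∃ l : ℝ≥0, (l : ℝ) = 2 / Γ := ⟨⟨2 / Γ, by positivity⟩, rfl⟩
  have hlb : 1 ≤ l * 1 := by
    have : (1 : ℝ) ≤ l := by rw [hl, le_div_iff₀ hΓ]; linarith
    rw [mul_one]
    exact_mod_cast this
  obtain ⟨g, hg, hgu⟩ := h l 1 hlb
  set F := maximalDist α l 1 hlb with hF
  have hup : upperPrice F Γ ≤ (2 : ℝ) := by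
    refine upperPrice_maximalDist_le hlb hΓ.le (by norm_num) ?_
    rw [hE, hl, NNReal.coe_one, mul_one, ← div_eq_mul_inv, div_lt_iff₀ (by positivity)]
    have : 2 / Γ * Γ = 2 := div_mul_cancel₀ _ hΓ.ne'
    linarith
  have hg0 := nonneg_of_mem_feasible hΓ.le hg
  have h1 : ∫⁻ s, ENNReal.ofReal (Γ * max s 0) ∂F.law < ⊤ := by
    refine lt_of_le_of_lt (b := ∫⁻ s, ENNReal.ofReal (g s) ∂F.law) (lintegral_mono_ae ?_) ?_
    · filter_upwards [ae_nonneg F] with s hs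
      rw [max_eq_left hs]
      exact ENNReal.ofReal_le_ofReal (mul_le_of_mem_feasible hΓ.le hg hs)
    · have h2 := hgu.trans hup
      rw [extExp_eq_lintegral F hg0] at h2
      refine lt_top_iff_ne_top.2 fun h3 => ?_
      rw [h3, EReal.coe_ennreal_top, top_le_iff] at h2
      exact EReal.coe_ne_top _ h2
  simp only [ENNReal.ofReal_mul hΓ.le] at h1
  rw [lintegral_const_mul _ (by fun_prop)] at h1
  have h2 : ∫⁻ s, ENNReal.ofReal (max s 0) ∂F.law < ⊤ :=
    (ENNReal.lt_top_of_mul_ne_top_right h1.ne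
      (by simpa using hΓ))
  rw [lintegral_eq_lintegral_meas_lt F.law (f := fun s => max s 0)
    (Eventually.of_forall fun s => le_max_right _ _) (by fun_prop)] at h2
  have h3 : ∫⁻ t in Ioi (1 : ℝ), ENNReal.ofReal ((1 + l : ℝ)⁻¹ * t⁻¹) < ⊤ := by
    refine lt_of_le_of_lt ?_ h2
    refine (setLIntegral_mono' measurableSet_Ioi fun t ht => ?_).trans
      (lintegral_mono_set (Ioi_subset_Ioi zero_le_one))
    have ht' : (1 : ℝ) < t := ht
    have h4 : {s : ℝ | t < max s 0} = Ioi t := by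
      ext s
      simp only [mem_ofPred_eq, lt_max_iff, mem_Ioi, or_iff_left_iff_imp]
      intro h5; linarith
    rw [h4, ← ofReal_measureReal, hF, maximalDist_real_Ioi hlb (by simpa using ht'.le), hE,
      NNReal.coe_one, ← mul_inv]
    refine ENNReal.ofReal_le_ofReal (inv_anti₀ ?_ ?_)
    · have : 0 ≤ (l : ℝ) * (t - 1) := mul_nonneg l.2 (by linarith)
      linarith
    · nlinarith [l.2]
  refine not_integrableOn_Ioi_inv (a := 1) ?_
  have h4 : IntegrableOn (fun t : ℝ => (1 + l : ℝ)⁻¹ * t⁻¹) (Ioi 1) := by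
    refine ⟨(by fun_prop : Measurable _).aestronglyMeasurable, ?_⟩
    rw [hasFiniteIntegral_iff_ofReal]
    · exact h3
    · filter_upwards [self_mem_ae_restrict measurableSet_Ioi] with t ht
      have : (0 : ℝ) < t := zero_lt_one.trans ht
      positivity
  have h5 := h4.const_mul (1 + l : ℝ)
  refine h5.congr (Eventually.of_forall fun t => ?_)
  have : (1 + l : ℝ) ≠ 0 := by positivity
  field_simp

/-- It is enough that some feasible function, not necessarily a minimizer, meets each upper
bound. -/
lemma mem_admissibleRatios_iff : Γ ∈ admissibleRatios α ↔ Γ ∈ Icc (0 : ℝ) 1 ∧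
    ∀ (l b : ℝ≥0) (hlb : 1 ≤ l * b), ∃ g ∈ feasible α Γ,
      extExp (maximalDist α l b hlb).law g ≤ upperPrice (maximalDist α l b hlb) Γ := by
  refine ⟨fun h => ⟨h.1, fun l b hlb => ?_⟩, fun h => ?_⟩
  · obtain ⟨g, hg, hgu⟩ := h.2 l b hlb
    exact ⟨g, hg.1, hgu⟩
  · rcases α.2.1.eq_or_lt with hα | hα
    · rcases h.1.1.eq_or_lt with rfl | hΓ
      · exact zero_mem_admissibleRatios α
      · exact (not_exists_feasible_of_eq_zero hα.symm hΓ h.2 h.1.2).elim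
    · refine ⟨h.1, fun l b hlb => ?_⟩
      obtain ⟨g, hg, hgu⟩ := h.2 l b hlb
      obtain ⟨G, hG⟩ := exists_isBuyerOptimal hα h.1.1 h.1.2 ⟨g, hg⟩ (maximalDist α l b hlb)
      exact ⟨G, hG, (hG.2 g hg).trans hgu⟩

lemma pos_of_mem_admissibleRatios (h : Γ ∈ admissibleRatios α) (hΓ : 0 < Γ) : (0 : ℝ) < α := by
  refine lt_of_le_of_ne α.2.1 fun hα => ?_
  exact not_exists_feasible_of_eq_zero hα.symm hΓ (mem_admissibleRatios_iff.1 h).2 h.1.2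

lemma bddAbove_admissibleRatios (α : Icc (0 : ℝ) 1) : BddAbove (admissibleRatios α) :=
  ⟨1, fun _ h => h.1.2⟩

lemma tightRatio_nonneg (α : Icc (0 : ℝ) 1) : 0 ≤ tightRatio α :=
  le_csSup (bddAbove_admissibleRatios α) (zero_mem_admissibleRatios α)

lemma tightRatio_le_one (α : Icc (0 : ℝ) 1) : tightRatio α ≤ 1 :=
  csSup_le ⟨0, zero_mem_admissibleRatios α⟩ fun _ h => h.1.2

lemma tightRatio_mem (α : Icc (0 : ℝ) 1) : tightRatio α ∈ admissibleRatios α := by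
  rcases (tightRatio_nonneg α).eq_or_lt with h0 | h0
  · rw [← h0]; exact zero_mem_admissibleRatios α
  obtain ⟨Γs, -, hlim, hmem⟩ := exists_seq_tendsto_sSup ⟨0, zero_mem_admissibleRatios α⟩
    (bddAbove_admissibleRatios α)
  change Tendsto Γs atTop (𝓝 (tightRatio α)) at hlim
  set Γ := tightRatio α
  obtain ⟨N, hN⟩ := eventually_atTop.1 (hlim.eventually (lt_mem_nhds (half_lt_self h0)))
  have hα : (0 : ℝ) < α := pos_of_mem_admissibleRatios (hmem N) ((half_pos h0).trans (hN N le_rfl))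
  refine mem_admissibleRatios_iff.2 ⟨⟨h0.le, tightRatio_le_one α⟩, fun l b hlb => ?_⟩
  choose g hg hgu using fun n => (mem_admissibleRatios_iff.1 (hmem (n + N))).2 l b hlb
  obtain ⟨hl0, hb0⟩ := maximalDist_pos hlb
  set F := maximalDist α l b hlb with hF
  obtain ⟨c', φ, hφ, hc'⟩ := CompactSpace.tendsto_subseq fun n => extExp F.law (g n)
  have hlim' : Tendsto (fun n => Γs (φ n + N)) atTop (𝓝 Γ) :=
    (hlim.comp (tendsto_add_atTop_nat N)).comp hφ.tendsto_atTop
  have hpos : ∀ n, 0 ≤ Γs n := fun n => (hmem n).1.1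
  -- The upper bounds are themselves bounded along the sequence, which bounds the functions.
  obtain ⟨x, hx1, hxb⟩ := (((tendsto_mul_survE_sub b hα α.2.2 hl0).eventually
    (gt_mem_nhds (mul_pos (half_pos h0) hb0))).and (eventually_ge_atTop (b : ℝ))).exists
  have hbound : ∀ n, extExp F.law (g n) ≤ (x : ℝ) := fun n => (hgu n).trans
    (upperPrice_maximalDist_le hlb (hpos _) hxb (hx1.trans_le
      (mul_le_mul_of_nonneg_right (hN _ (by omega)).le hb0.le)))
  obtain ⟨G, hG, hGc⟩ := exists_feasible_limit F (fun n => hpos (φ n + N)) h0.le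
    (tightRatio_le_one α) hlim' (fun n => hg (φ n)) (B := fun s => x / F.law.real (Ici s))
    (fun n s hs => by
      have hp : 0 < F.law.real (Ici s) := by
        rcases le_total s b with h1 | h1
        · refine lt_of_lt_of_le ?_ (real_Ici_anti F h1)
          rw [hF, maximalDist_real_Ici hlb le_rfl, sub_self, mul_zero, survE_zero]
          exact one_pos
        · rw [hF, maximalDist_real_Ici hlb h1]
          exact survE_pos (one_add_mul_pos α.2.2 (mul_nonneg hl0.le (sub_nonneg.2 h1)))
      rw [le_div_iff₀ hp]
      exact EReal.coe_le_coe_iff.1 ((mul_real_Ici_le_extExp F (hg _).1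
        (nonneg_of_mem_feasible (hpos _) (hg _)) hs).trans (hbound _)))
    (fun n => le_rfl) hc'
  refine ⟨G, hG, hGc.trans (not_lt.1 fun hlt => ?_)⟩
  obtain ⟨p, hp1, hp2⟩ := EReal.lt_iff_exists_real_btwn.1 hlt
  have hopt : opt F = (b : ℝ) := opt_maximalDist hlb
  have hbp : (b : ℝ) ≤ p := by
    refine EReal.coe_le_coe_iff.1 (le_trans (le_upperPrice ?_) hp1.le)
    refine (mul_opt_le h0.le hopt.le).trans (EReal.coe_le_coe_iff.2 ?_)
    rw [hF, rev_maximalDist_self hlb]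
    exact mul_le_of_le_one_left hb0.le (tightRatio_le_one α)
  have hrev : rev p F < Γ * b := by
    by_contra hcon
    refine absurd (le_upperPrice ?_) (not_le.2 hp1)
    exact (mul_opt_le h0.le hopt.le).trans (EReal.coe_le_coe_iff.2 (not_lt.1 hcon))
  refine absurd (le_of_tendsto hc' ?_) (not_le.2 hp2)
  filter_upwards [(hlim'.mul_const (b : ℝ)).eventually (lt_mem_nhds hrev)] with n hn
  refine (hgu (φ n)).trans (upperPrice_maximalDist_le hlb (hpos _) hbp ?_)
  rwa [← rev_maximalDist hlb hbp]

lemma exists_isOptimalRule (α : Icc (0 : ℝ) 1) : ∃ h, IsOptimalRule α (tightRatio α) h := by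
  have hex : ∀ F : ValueDist, ∃ g, IsBuyerOptimal α (tightRatio α) F g := fun F => by
    rcases (tightRatio_nonneg α).eq_or_lt with h0 | h0
    · rw [← h0]; exact ⟨_, isBuyerOptimal_zero F⟩
    · have hm := tightRatio_mem α
      obtain ⟨g, hg, -⟩ := (mem_admissibleRatios_iff.1 hm).2 1 1 (by simp)
      exact exists_isBuyerOptimal (pos_of_mem_admissibleRatios hm h0) hm.1.1 hm.1.2 ⟨g, hg⟩ F
  choose g hg using hex
  exact ⟨fun s F => g F s, hg⟩

end attained

/-! ### The optimal rule -/

section optimalRule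

variable {α : Icc (0 : ℝ) 1} {Γ : ℝ} {h : ℝ → ValueDist → ℝ}

lemma IsOptimalRule.nonneg (hh : IsOptimalRule α Γ h) (hΓ : 0 ≤ Γ) (F : ValueDist) (s : ℝ)
    (hs : 0 ≤ s) : 0 ≤ h s F := nonneg_of_mem_feasible hΓ (hh F).1 s hs

/-- Properness is the defining minimization: every function `h(·, F')` is a feasible competitor of
`h(·, F)`. -/
lemma IsOptimalRule.isProperRule (hh : IsOptimalRule α Γ h) (hΓ : 0 ≤ Γ) : IsProperRule h where
  measurable F' := (hh F').1.1.measurable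
  quasiIntegrable F F' := Or.inr (by
    rw [lintegral_ofReal_neg F (hh.nonneg hΓ F')]
    exact ENNReal.zero_ne_top)
  proper F F' := (hh F).2 _ (hh F').1

lemma IsOptimalRule.isMonotoneRule (hh : IsOptimalRule α Γ h) (hΓ : 0 ≤ Γ) : IsMonotoneRule h :=
  fun F₁ F₂ hdom => ((hh F₂).2 _ (hh F₁).1).trans
    (hdom.extExp_le (hh F₁).1.1 (hh.nonneg hΓ F₁))

/-- The implemented price is `Γ`-approximate on every regular distribution. A price that is too low
would be too low on a dominated minimal distribution, against the feasibility constraint; a price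
that is too high would be too high on a dominating maximal distribution, against the admissibility
of `Γ`. -/
lemma IsOptimalRule.isApprox (hh : IsOptimalRule α Γ h) (hΓ : Γ ∈ admissibleRatios α) :
    (hiddenMechanism h).IsApprox α Γ := fun F hF => by
  have h0 := hh.nonneg hΓ.1.1
  have hmeas : Measurable fun s => h s F := (hh F).1.1.measurable
  have hrev0 : 0 ≤ (hiddenMechanism h).revenue F := by
    rw [revenue_hiddenMechanism hmeas (h0 F)]
    exact EReal.coe_ennreal_nonneg _
  rcases hΓ.1.1.eq_or_lt with rfl | hΓ0
  · simpa using hrev0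
  rcases (opt_nonneg F).eq_or_lt with hopt | hopt
  · rw [← hopt, mul_zero]; exact hrev0
  have hα0 := pos_of_mem_admissibleRatios hΓ hΓ0
  obtain ⟨a, ha, hra, hmax⟩ := hF.exists_optimal_price hα0 hopt
  have hΓra : 0 < Γ * rev a F := mul_pos hΓ0 hra
  refine (mul_opt_le hΓ0.le (opt_le hmax)).trans ?_
  have hup : ∀ x, a < x → rev x F < Γ * rev a F → policy h F ≤ (x : ℝ) := fun x hax hx => by
    rw [← EReal.le_of_forall_lt_iff_le]
    intro z hz
    obtain ⟨l, b, hlb, hdom, hle⟩ := hF.exists_maximalDist hα0 hΓ0 hΓ.1.2 ha hax hx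
      (sub_pos.2 (EReal.coe_lt_coe_iff.1 hz))
    rw [add_sub_cancel] at hle
    obtain ⟨g, hg, hgu⟩ := hΓ.2 l b hlb
    exact ((hh.isMonotoneRule hΓ0.le _ _ hdom).trans ((hh _).2 g hg.1)).trans (hgu.trans hle)
  have htop : policy h F ≠ ⊤ := by
    obtain ⟨x, hx1, hx2⟩ := (((hF.tendsto_rev hα0).eventually (gt_mem_nhds hΓra)).and
      (eventually_gt_atTop a)).exists
    exact ((hup x hx2 hx1).trans_lt (EReal.coe_lt_top x)).ne
  have hpol0 : 0 ≤ policy h F := extExp_nonneg F (h0 F)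
  obtain ⟨p, hp⟩ : ∃ p : ℝ, policy h F = p :=
    ⟨(policy h F).toReal, (EReal.coe_toReal htop
      (ne_of_gt ((EReal.bot_lt_coe 0).trans_le hpol0))).symm⟩
  rw [revenue_of_policy_eq_coe hmeas (h0 F) hp, EReal.coe_le_coe_iff]
  have hp0 : 0 ≤ p := by rw [hp] at hpol0; exact EReal.coe_nonneg.1 hpol0
  by_contra hcon
  have hlt : rev p F < Γ * rev a F := not_le.1 hcon
  rcases lt_trichotomy p a with hpa | rfl | hpa
  · lift a to ℝ≥0 using ha.le
    obtain ⟨l, hla, hdom, hreq, hrle⟩ := hF.exists_minimalDist hα0 (by exact_mod_cast ha) hra hmax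
    set M := minimalDist α l a with hM
    have h1 : lowerPrice M Γ ≤ (p : ℝ) := by
      rw [← hp]
      exact ((hh F).1.2 l a hla).trans (hdom.extExp_le (hh F).1.1 (h0 F))
    -- Slightly higher prices still earn too little on the minimal distribution.
    have hc : ContinuousAt (fun q : ℝ => q * survE α (l * q)) p := by
      have h2 : ContinuousAt (survE α) (l * p) :=
        (hasDerivAt_survE (one_add_mul_pos α.2.2 (by positivity))).continuousAt
      exact continuousAt_id.mul (ContinuousAt.comp (g := survE α) h2 (by fun_prop))
    have h3 : p * survE α (l * p) < Γ * rev a F := by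
      rw [← rev_minimalDist (α := α) hp0 hpa.le]
      exact (hrle p hp0 hpa.le).trans_lt hlt
    obtain ⟨q, hq1, hq2⟩ := (((hc.tendsto.eventually (gt_mem_nhds h3)).filter_mono
      nhdsWithin_le_nhds).and (Ioo_mem_nhdsGT hpa)).exists
    have h4 : (q : EReal) ≤ lowerPrice M Γ := by
      refine le_lowerPrice hΓ0.le (R := rev a F) (by rw [← hreq, hM, opt_minimalDist hla])
        fun r hr => ?_
      refine (rev_minimalDist_mono hla hr.le hq2.2.le).trans_lt ?_
      rwa [rev_minimalDist (hp0.trans hq2.1.le) hq2.2.le]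
    exact absurd (EReal.coe_le_coe_iff.1 (h4.trans h1)) (not_le.2 hq2.1)
  · exact hcon (mul_le_of_le_one_left hra.le hΓ.1.2)
  · have hp' : 0 < p := ha.trans hpa
    have h1 : F.law.real (Ici p) < Γ * rev a F / p := by
      rwa [lt_div_iff₀ hp', mul_comm]
    obtain ⟨v, hav, hvp, hv⟩ := exists_real_Ici_lt F h1 hpa
    have h2 : rev v F < Γ * rev a F := by
      rw [lt_div_iff₀ hp', mul_comm] at hv
      exact (mul_le_mul_of_nonneg_right hvp.le measureReal_nonneg).trans_lt hv
    have h3 := hup v hav h2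
    rw [hp, EReal.coe_le_coe_iff] at h3
    linarith

end optimalRule

/-! ### Regularity of the extremal distributions -/

section extremalRegular

variable {α : Icc (0 : ℝ) 1}

lemma hasDerivAt_one_sub_survE {l b v : ℝ} (hl : 0 ≤ l) (hv : b ≤ v) :
    HasDerivAt (fun v => 1 - survE α (l * (v - b)))
      (l * survE α (l * (v - b)) / (1 + (1 - α) * (l * (v - b)))) v := by
  have h1 : HasDerivAt (fun v : ℝ => l * (v - b)) l v := by
    simpa using ((hasDerivAt_id v).sub_const b).const_mul l
  have h0 : 0 < 1 + (1 - (α : ℝ)) * (l * (v - b)) :=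
    one_add_mul_pos α.2.2 (mul_nonneg hl (sub_nonneg.2 hv))
  have h2 := HasDerivAt.comp (h₂ := survE α) (h := fun v => l * (v - b)) v (hasDerivAt_survE h0) h1
  refine (h2.const_sub 1).congr_deriv ?_
  ring

/-- A distribution with a shifted generalized Pareto survival function below its top is regular:
its virtual value is constant on the support. -/
lemma isRegular_of_cdf_eq {F : ValueDist} {l b : ℝ} (hl : 0 ≤ l)
    (h : ∀ v, F.cdf v < 1 → F.cdf v = if v < b then 0 else 1 - survE α (l * (v - b))) :
    IsRegular α F := by
  have hα : (α : ℝ) ≤ 1 := α.2.2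
  have hD : ∀ v, b ≤ v → 0 < 1 + (1 - (α : ℝ)) * (l * (v - b)) := fun v hv =>
    one_add_mul_pos hα (mul_nonneg hl (sub_nonneg.2 hv))
  set k : ℝ → ℝ := fun v => l * survE α (l * (v - b)) / (1 + (1 - α) * (l * (v - b))) with hk
  have hE : Measurable (survE α) := by
    unfold survE
    split_ifs <;> fun_prop
  have hkm : Measurable k := by fun_prop
  have hk0 : ∀ v, b ≤ v → 0 ≤ k v := fun v hv =>
    div_nonneg (mul_nonneg hl (survE_pos (hD v hv)).le) (hD v hv).le
  refine ⟨fun v => if v < b then 0 else (k v).toNNReal,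
    Measurable.ite measurableSet_Iio measurable_const hkm.real_toNNReal, fun v hv => ?_, ?_⟩
  · have h1 : F.law (Iic v) = ENNReal.ofReal (F.cdf v) := (ofReal_measureReal (by finiteness)).symm
    have hfun : (fun x => (((if x < b then 0 else (k x).toNNReal : ℝ≥0)) : ℝ≥0∞))
        = (Ici b).indicator fun x => ENNReal.ofReal (k x) := by
      funext x
      by_cases hx : x < b
      · simp [hx]
      · rw [if_neg hx, indicator_of_mem (show x ∈ Ici b from not_lt.1 hx)]
        rfl
    rw [h1, h v hv, hfun, setLIntegral_indicator measurableSet_Ici, Ici_inter_Iic]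
    split_ifs with hvb
    · simp [Icc_eq_empty (not_le.2 hvb)]
    · have hbv : b ≤ v := not_lt.1 hvb
      have hcont : ContinuousOn k (Icc b v) := fun x hx => by
        have h2 : ContinuousAt (fun x => survE α (l * (x - b))) x :=
          ContinuousAt.comp (g := survE α) (f := fun x => l * (x - b))
            (hasDerivAt_survE (hD x hx.1)).continuousAt (by fun_prop)
        exact ((continuousAt_const.mul h2).div (by fun_prop) (hD x hx.1).ne').continuousWithinAt
      have hint : IntervalIntegrable k volume b v :=
        ContinuousOn.intervalIntegrable (by rwa [uIcc_of_le hbv])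
      have hftc : ∫ x in b..v, k x = 1 - survE α (l * (v - b)) := by
        rw [intervalIntegral.integral_eq_sub_of_hasDerivAt (fun x hx =>
          hasDerivAt_one_sub_survE hl (by rw [uIcc_of_le hbv] at hx; exact hx.1)) hint]
        simp [survE_zero]
      rw [← hftc, intervalIntegral.integral_of_le hbv, ← integral_Icc_eq_integral_Ioc,
        ofReal_integral_eq_lintegral_ofReal hcont.integrableOn_Icc]
      filter_upwards [self_mem_ae_restrict measurableSet_Icc] with x hx using hk0 x hx.1
  · intro x hx y hy hxy
    by_cases hxb : x < b
    · simp [virtualValue, hxb]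
    have hbx : b ≤ x := not_lt.1 hxb
    rcases hl.eq_or_lt with rfl | hl0
    · simp [virtualValue, hk]
    have hval : ∀ v, F.cdf v < 1 → b ≤ v → virtualValue α F
        (fun v => if v < b then 0 else (k v).toNNReal) v = (((1 - α) * b - 1 / l : ℝ) : EReal) :=
      fun v hv hbv => by
        have hEv := survE_pos (hD v hbv)
        have hkv : 0 < k v := div_pos (mul_pos hl0 hEv) (hD v hbv)
        have hnb : ¬ v < b := not_lt.2 hbv
        rw [virtualValue, if_neg hnb, if_neg (by simpa using hkv), h v hv, if_neg hnb,
          Real.coe_toNNReal _ hkv.le, hk]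
        congr 1
        simp only
        rw [sub_sub_cancel, div_div_eq_mul_div, mul_comm l (survE α _), mul_div_mul_left _ _ hEv.ne']
        field_simp
        ring
    rw [hval x hx hbx, hval y hy (hbx.trans hxy)]

lemma isRegular_minimalDist (l a : ℝ≥0) : IsRegular α (minimalDist α l a) := by
  refine isRegular_of_cdf_eq (l := l) (b := 0) l.2 fun v hv => ?_
  rw [minimalDist_cdf] at hv ⊢
  split_ifs with h1 h2
  · rfl
  · rw [sub_zero]
  · rw [if_neg h1, if_neg h2] at hv
    exact absurd hv (lt_irrefl _)

lemma isRegular_maximalDist (l b : ℝ≥0) (hlb : 1 ≤ l * b) :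
    IsRegular α (maximalDist α l b hlb) :=
  isRegular_of_cdf_eq (l := l) (b := b) l.2 fun v _ => maximalDist_cdf α l b hlb v

end extremalRegular

/-! ### Optimality of the tight ratio -/

section impossibility

/-- The largest non-decreasing function on `[0, ∞)` that lies below `k`, extended to the left by its
value at zero. It is used for non-negative `k`, for which the infimum is not a junk value. -/
noncomputable def monoHull (k : ℝ → ℝ) (s : ℝ) : ℝ := ⨅ t : Ici (max s 0), k t

variable {k : ℝ → ℝ}

lemma monoHull_le (hk : ∀ t, 0 ≤ t → 0 ≤ k t) {s t : ℝ} (ht : 0 ≤ t) (hst : s ≤ t) :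
    monoHull k s ≤ k t :=
  ciInf_le (f := fun t : Ici (max s 0) => k t)
    ⟨0, by rintro _ ⟨t, rfl⟩; exact hk _ ((le_max_right _ _).trans t.2)⟩ ⟨t, max_le hst ht⟩

lemma monoHull_nonneg (hk : ∀ t, 0 ≤ t → 0 ≤ k t) (s : ℝ) : 0 ≤ monoHull k s :=
  Real.iInf_nonneg fun t => hk _ ((le_max_right _ _).trans t.2)

lemma monotone_monoHull (hk : ∀ t, 0 ≤ t → 0 ≤ k t) : Monotone (monoHull k) := fun s s' hss => by
  have : Nonempty (Ici (max s' 0)) := ⟨⟨_, self_mem_Ici⟩⟩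
  exact le_ciInf fun t => monoHull_le hk ((le_max_right _ _).trans t.2)
    (hss.trans ((le_max_left _ _).trans t.2))

/-- A measurable choice of points to the right of `s` at which `k` nearly attains its infimum over
`[s, ∞)`. Countably many points suffice, because a monotone function has only countably many
discontinuities. -/
lemma exists_measurable_selection (hk : ∀ t, 0 ≤ t → 0 ≤ k t) {ε : ℝ} (hε : 0 < ε) :
    ∃ T : ℝ → ℝ, Measurable T ∧ ∀ s, max s 0 ≤ T s ∧ k (T s) ≤ monoHull k s + ε := by
  have hm := monotone_monoHull hk
  set C : Set ℝ := range ((↑) : ℚ → ℝ) ∪ {x | ¬ ContinuousAt (monoHull k) x} with hC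
  have hCc : C.Countable := (countable_range _).union hm.countable_not_continuousAt
  obtain ⟨u, hu⟩ := hCc.exists_eq_range ⟨_, Or.inl ⟨0, rfl⟩⟩
  have hex : ∀ n, ∃ t, max (u n) 0 ≤ t ∧ k t < monoHull k (u n) + ε / 2 := fun n => by
    have : Nonempty (Ici (max (u n) 0)) := ⟨⟨_, self_mem_Ici⟩⟩
    obtain ⟨t, ht⟩ := exists_lt_of_ciInf_lt
      (show (⨅ t : Ici (max (u n) 0), k t) < monoHull k (u n) + ε / 2 by
        change monoHull k (u n) < _; linarith)
    exact ⟨t, t.2, ht⟩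
  choose t ht hkt using hex
  have hfind : ∀ s, ∃ n, max s 0 ≤ t n ∧ k (t n) ≤ monoHull k s + ε := fun s => by
    by_cases hs : ContinuousAt (monoHull k) s
    · obtain ⟨y, hy, hsy⟩ := (((hs.tendsto.eventually (gt_mem_nhds
        (lt_add_of_pos_right (monoHull k s) (half_pos hε)))).filter_mono
        nhdsWithin_le_nhds).and (self_mem_nhdsWithin (a := s) (s := Ioi s))).exists
      obtain ⟨q, hq1, hq2⟩ := exists_rat_btwn hsy
      obtain ⟨n, hn⟩ : (q : ℝ) ∈ range u := hu ▸ Or.inl ⟨q, rfl⟩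
      refine ⟨n, le_trans (max_le_max_right 0 (by rw [hn]; exact hq1.le)) (ht n), ?_⟩
      have h1 := hkt n
      rw [hn] at h1
      linarith [hm hq2.le]
    · obtain ⟨n, hn⟩ : s ∈ range u := hu ▸ Or.inr hs
      refine ⟨n, by rw [← hn]; exact ht n, ?_⟩
      have h1 := hkt n
      rw [hn] at h1
      linarith
  classical
  refine ⟨fun s => t (Nat.find (hfind s)), ?_, fun s => Nat.find_spec (hfind s)⟩
  refine (measurable_from_nat (f := t)).comp (measurable_find hfind fun n => ?_)
  exact (measurableSet_le (measurable_id.max measurable_const) measurable_const).inter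
    (measurableSet_le measurable_const (hm.measurable.add_const _))

variable {α : Icc (0 : ℝ) 1} {Γ : ℝ} {h : ℝ → ValueDist → ℝ}

lemma policy_pointMass (s : ℝ≥0) : policy h (minimalDist α 0 s) = (h s (minimalDist α 0 s) : ℝ) :=
  extExp_pointMass _

lemma nonneg_at_zero_of_isApprox (hΓ : 0 ≤ Γ) (ha : (hiddenMechanism h).IsApprox α Γ) :
    0 ≤ h 0 (minimalDist α 0 0) := by
  by_contra hneg
  set δ := minimalDist α 0 0
  have h1 := ha δ (isRegular_minimalDist 0 0)
  have h2 : (hiddenMechanism h).revenue δ = (h 0 δ : ℝ) := by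
    refine extExp_of_ae_eq ?_
    filter_upwards [Measure.quasiMeasurePreserving_fst.ae (pointMass_ae_eq (α := α) (a := 0)),
      Measure.quasiMeasurePreserving_snd.ae (pointMass_ae_eq (α := α) (a := 0))] with z hz1 hz2
    have h3 : policy h δ = (h 0 δ : ℝ) := policy_pointMass 0
    have h4 : policy h δ ≤ (z.2 : ℝ) := by
      rw [h3, hz2, EReal.coe_le_coe_iff]
      exact (not_le.1 hneg).le
    simp only [hiddenMechanism, if_pos h4, one_mul, hz1, NNReal.coe_zero]
  rw [h2] at h1
  have h5 : (0 : EReal) ≤ (Γ : EReal) * opt δ := mul_nonneg (EReal.coe_nonneg.2 hΓ) (opt_nonneg δ)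
  exact hneg (EReal.coe_nonneg.1 (h5.trans h1))

/-- Point masses show that an approximate monotone proper rule never pays the buyer. -/
lemma rule_nonneg (hp : IsProperRule h) (hm : IsMonotoneRule h) (hΓ : 0 ≤ Γ)
    (ha : (hiddenMechanism h).IsApprox α Γ) (F : ValueDist) (s : ℝ) (hs : 0 ≤ s) :
    0 ≤ h s F := by
  lift s to ℝ≥0 using hs
  have h1 : Dominates (minimalDist α 0 s) (minimalDist α 0 0) := fun v => by
    by_cases hv : v < 0
    · rw [minimalDist_cdf, minimalDist_cdf, if_pos hv, if_pos hv]
    · refine (cdf_le_one _ v).trans_eq ?_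
      rw [minimalDist_cdf, if_neg hv, NNReal.coe_zero, if_neg hv]
  have h2 := (hm _ _ h1).trans (hp.proper (minimalDist α 0 s) F)
  rw [policy_pointMass, extExp_pointMass, EReal.coe_le_coe_iff] at h2
  exact (nonneg_at_zero_of_isApprox hΓ ha).trans h2

/-- A `Γ`-approximate proper monotone rule yields a feasible pricing function that meets the upper
bound on a given maximal distribution `F`, namely the monotone hull of `h(·, F)`. It is feasible
because its expectation under a minimal distribution is nearly the expectation of `h(·, F)` under a
distribution that dominates the minimal one. -/
lemma exists_feasible_of_isApprox (hp : IsProperRule h) (hm : IsMonotoneRule h) (hΓ : 0 < Γ)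
    (ha : (hiddenMechanism h).IsApprox α Γ) (l b : ℝ≥0) (hlb : 1 ≤ l * b) :
    ∃ g ∈ feasible α Γ,
      extExp (maximalDist α l b hlb).law g ≤ upperPrice (maximalDist α l b hlb) Γ := by
  have h0 := rule_nonneg hp hm hΓ.le ha
  have hreal : ∀ F, policy h F ≠ ⊤ → ∃ p : ℝ, policy h F = p := fun F hF =>
    ⟨(policy h F).toReal, (EReal.coe_toReal hF (ne_of_gt ((EReal.bot_lt_coe 0).trans_le
      (extExp_nonneg F (h0 F))))).symm⟩
  set F := maximalDist α l b hlb with hF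
  have hk := h0 F
  set k : ℝ → ℝ := fun s => h s F
  have hg0 : ∀ s, 0 ≤ s → 0 ≤ monoHull k s := fun s _ => monoHull_nonneg hk s
  refine ⟨monoHull k, ⟨monotone_monoHull hk, fun m a hma => ?_⟩, ?_⟩
  · set M := minimalDist α m a
    have h1 : lowerPrice M Γ ≤ policy h M := by
      by_cases htop : policy h M = ⊤
      · rw [htop]; exact le_top
      · obtain ⟨p, hpM⟩ := hreal M htop
        rw [hpM]
        refine lowerPrice_le ?_
        rw [← revenue_of_policy_eq_coe (hp.measurable M) (h0 M) hpM]
        exact ha M (isRegular_minimalDist m a)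
    refine h1.trans ?_
    have h2 : ∀ ε : ℝ≥0, 0 < ε → policy h M
        ≤ ((∫⁻ s, ENNReal.ofReal (monoHull k s) ∂M.law + ε : ℝ≥0∞) : EReal) := fun ε hε => by
      obtain ⟨T, hT, hTs⟩ := exists_measurable_selection hk (ε := ε) hε
      -- The law of `T(s)` dominates that of `s`.
      let F' : ValueDist :=
        { law := M.law.map T
          isProb := Measure.isProbabilityMeasure_map hT.aemeasurable
          nonneg := by
            rw [Measure.map_apply hT measurableSet_Iio]
            convert measure_empty (μ := M.law)
            exact eq_empty_of_forall_notMem fun s hs =>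
              absurd ((le_max_right _ _).trans (hTs s).1) (not_le.2 hs) }
      have hdom : Dominates F' M := fun v => by
        change (M.law.map T).real (Iic v) ≤ M.law.real (Iic v)
        rw [map_measureReal_apply hT measurableSet_Iic]
        exact measureReal_mono fun s hs => ((le_max_left _ _).trans (hTs s).1).trans hs
      refine (hm _ _ hdom).trans ((hp.proper F' F).trans ?_)
      rw [extExp_eq_lintegral F' hk, EReal.coe_ennreal_le_coe_ennreal_iff]
      change ∫⁻ s, ENNReal.ofReal (k s) ∂(M.law.map T) ≤ _
      rw [lintegral_map (hp.measurable F).ennreal_ofReal hT]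
      calc ∫⁻ s, ENNReal.ofReal (k (T s)) ∂M.law
          ≤ ∫⁻ s, (ENNReal.ofReal (monoHull k s) + ε) ∂M.law := by
            refine lintegral_mono fun s => ?_
            refine (ENNReal.ofReal_le_ofReal (hTs s).2).trans (ENNReal.ofReal_add_le.trans ?_)
            rw [ENNReal.ofReal_coe_nnreal]
        _ = _ := by
            rw [lintegral_add_right _ measurable_const]
            simp
    rw [extExp_eq_lintegral M hg0]
    rw [policy, extExp_eq_lintegral M (h0 M)] at h2 ⊢
    simp only [EReal.coe_ennreal_le_coe_ennreal_iff] at h2 ⊢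
    exact ENNReal.le_of_forall_pos_le_add fun ε hε _ => h2 ε hε
  · have h1 : extExp F.law (monoHull k) ≤ policy h F :=
      extExp_le_extExp F hg0 fun s hs => monoHull_le hk hs le_rfl
    have h2 := ha F (isRegular_maximalDist l b hlb)
    have htop : policy h F ≠ ⊤ := fun htop => by
      rw [revenue_of_policy_eq_top (hp.measurable F) hk htop, hF, opt_maximalDist hlb,
        ← EReal.coe_mul, ← EReal.coe_zero, EReal.coe_le_coe_iff] at h2
      exact absurd h2 (not_le.2 (mul_pos hΓ (maximalDist_pos hlb).2))
    obtain ⟨p, hpF⟩ := hreal F htop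
    rw [revenue_of_policy_eq_coe (hp.measurable F) hk hpF] at h2
    exact h1.trans (hpF ▸ le_upperPrice h2)

lemma le_one_of_isApprox (hp : IsProperRule h) (hm : IsMonotoneRule h) (hΓ : 0 ≤ Γ)
    (ha : (hiddenMechanism h).IsApprox α Γ) : Γ ≤ 1 := by
  set δ := minimalDist α 0 1 with hδ
  have h1 := ha δ (isRegular_minimalDist 0 1)
  have h2 : opt δ = (1 : ℝ) := by
    rw [hδ, opt_minimalDist (by simp), rev_minimalDist NNReal.zero_le_coe le_rfl]
    simp [survE_zero]
  rw [h2, revenue_of_policy_eq_coe (hp.measurable δ) (rule_nonneg hp hm hΓ ha δ)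
    (policy_pointMass 1), ← EReal.coe_mul, EReal.coe_le_coe_iff, mul_one] at h1
  exact h1.trans (EReal.coe_le_coe_iff.1 ((rev_le_opt _ _).trans h2.le))

end impossibility

end HiddenPricing

theorem mainTheorem2 (α : Set.Icc (0 : ℝ) 1) :
    IsGreatest (HiddenPricing.admissibleRatios α) (HiddenPricing.tightRatio α) ∧
    (∃ h, HiddenPricing.IsOptimalRule α (HiddenPricing.tightRatio α) h) ∧
    (∀ h, HiddenPricing.IsOptimalRule α (HiddenPricing.tightRatio α) h →
      HiddenPricing.IsProperRule h ∧ HiddenPricing.IsMonotoneRule h ∧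
      (HiddenPricing.hiddenMechanism h).IsApprox α (HiddenPricing.tightRatio α)) ∧
    (∀ h, HiddenPricing.IsProperRule h → HiddenPricing.IsMonotoneRule h →
      ∀ Γ : ℝ, HiddenPricing.tightRatio α < Γ →
        ¬ (HiddenPricing.hiddenMechanism h).IsApprox α Γ) := by
  have hΓ0 := HiddenPricing.tightRatio_nonneg α
  have hmem := HiddenPricing.tightRatio_mem α
  have hle : ∀ Γ ∈ HiddenPricing.admissibleRatios α, Γ ≤ HiddenPricing.tightRatio α := fun Γ hΓ =>
    le_csSup (HiddenPricing.bddAbove_admissibleRatios α) hΓ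
  refine ⟨⟨hmem, hle⟩, HiddenPricing.exists_isOptimalRule α,
    fun h hh => ⟨hh.isProperRule hΓ0, hh.isMonotoneRule hΓ0, hh.isApprox hmem⟩,
    fun h hp hm Γ hΓ ha => not_le.2 hΓ (hle Γ ?_)⟩
  have hpos := hΓ0.trans_lt hΓ
  exact HiddenPricing.mem_admissibleRatios_iff.2
    ⟨⟨hpos.le, HiddenPricing.le_one_of_isApprox hp hm hpos.le ha⟩,
      fun l b hlb => HiddenPricing.exists_feasible_of_isApprox hp hm hpos ha l b hlb⟩
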